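/- Conventions: 2-categories and 2-functors are strict; $(-)^{op}$ reverses 1-cells only; $\mathcal{C}at$ is the 2-category of small categories. For a 2-category $\mathcal{A}$ with small hom-categories, $\mathcal{H}om_p(\mathcal{A},\mathcal{C}at)$ is the 2-category of 2-functors $\mathcal{A}\to\mathcal{C}at$, pseudonatural transformations and modifications. Let $F:\mathcal{I}\to\mathcal{B}$ be a 2-functor and $\Sigma$ a 1-subcategory of $\mathcal{I}$ containing all objects. A $\sigma$-cone for $F$ with vertex $E\in\mathcal{B}$ (with respect to $\Sigma$) consists of arrows $\theta_i:Fi\to E$ and 2-cells $\theta_f:\theta_j\,F(f)\Rightarrow\theta_i$ for $f:i\to j$, satisfying the lax cone equations (compatibility with identities, composition and 2-cells), with $\theta_f$ invertible whenever $f\in\Sigma$. With all morphisms of lax cones these form a category $Cones_\sigma(F,E)$. A $\sigma$-cone $\lambda$ with vertex $L$ is a (conical) $\sigma$-colimit of $F$ if for every $E$ the functor $\lambda^*:\mathcal{B}(L,E)\to Cones_\sigma(F,E)$ is an isomorphism of categories, and a (conical) $\sigma$-bicolimit if every $\lambda^*$ is an equivalence of categories. For a 2-functor $P:\mathcal{A}\to\mathcal{C}at$,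 let $\mathcal{E}l_P$ be its 2-category of elements: objects are pairs $(x,A)$ with $A\in\mathcal{A}$, $x\in PA$; arrows $(x,A)\to(y,B)$ are pairs $(f,\varphi)$ with $f:A\to B$ and $\varphi:Pf(x)\to y$; 2-cells $(f,\varphi)\Rightarrow(g,\psi)$ are 2-cells $\theta:f\Rightarrow g$ of $\mathcal{A}$ with $\psi\circ(P\theta)_x=\varphi$; composition of arrows is $(g,\psi)(f,\varphi)=(gf,\psi\circ Pg(\varphi))$. Let $Cart_P$ be the family of arrows $(f,\varphi)$ with $\varphi$ invertible, regarded in $\mathcal{E}l_P^{op}$, and let $D_P$ be the composite 2-functor $\mathcal{E}l_P^{op}\to\mathcal{A}^{op}\to\mathcal{H}om_p(\mathcal{A},\mathcal{C}at)$, $(x,A)\mapsto A\mapsto\mathcal{A}(A,-)$, of the projection and the Yoneda 2-functor. **Proposition.** For every 2-functor $P:\mathcal{A}\to\mathcal{C}at$ there is a pseudo-equivalence, that is, an equivalence in $\mathcal{H}om_p(\mathcal{A},\mathcal{C}at)$, between $P$ and the conical $\sigma$-colimit of $D_P$ with respect to $Cart_P$: $$P\;\approx\;\underset{(x,A)\in\mathcal{E}l_P^{op}}{\sigma\text{-}\mathrm{colim}}\;\mathcal{A}(A,-).$$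 Precisely: (1) every conical $\sigma$-colimit of $D_P$ with respect to $Cart_P$ in $\mathcal{H}om_p(\mathcal{A},\mathcal{C}at)$ is equivalent to $P$ in $\mathcal{H}om_p(\mathcal{A},\mathcal{C}at)$; (2) such a $\sigma$-colimit exists if $\mathcal{A}$ has (up to bijection) a small set of objects; (3) $P$ itself is the vertex of a $\sigma$-cone for $D_P$ that is a conical $\sigma$-bicolimit with respect to $Cart_P$ in $\mathcal{H}om_p(\mathcal{A},\mathcal{C}at)$. -/

import Mathlib

open CategoryTheory Bicategory Opposite
open scoped CategoryTheory.Pseudofunctor.StrongTrans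

universe w v u w₁ v₁ u₁ w₂ v₂ u₂

/-!
Throughout, a `2`-category is a bicategory with `Bicategory.Strict`, and a `2`-functor is a
`StrictPseudofunctor`. As in Mathlib, `f ≫ g` is `f` followed by `g`, and `Bᵒᵖ` reverses the
`1`-cells but not the `2`-cells.
-/

namespace TwoCat

section General

variable {I : Type u₁} [Bicategory.{w₁, v₁} I] {B : Type u₂} [Bicategory.{w₂, v₂} B]

/-- A `1`-subcategory of a `2`-category that contains all the objects. -/
structure WideSub (I : Type u₁) [Bicategory.{w₁, v₁} I] where
  /-- The arrows that belong to the subcategory. -/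
  mem : ∀ ⦃i j : I⦄, (i ⟶ j) → Prop
  id_mem : ∀ i : I, mem (𝟙 i)
  comp_mem : ∀ ⦃i j k : I⦄ (f : i ⟶ j) (g : j ⟶ k), mem f → mem g → mem (f ≫ g)

/-- The same family of arrows, in the opposite `2`-category. -/
def WideSub.op (S : WideSub I) : WideSub Iᵒᵖ where
  mem _ _ f := S.mem f.unop
  id_mem i := S.id_mem i.unop
  comp_mem _ _ _ f g hf hg := S.comp_mem g.unop f.unop hg hf

/-- A `σ`-cone (with respect to `S`) for the `2`-functor `F`, with vertex `E`: a lax cone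
`θ_i : F i ⟶ E`, `θ_f : θ_j F(f) ⟹ θ_i` for `f : i ⟶ j`, with `θ_f` invertible for `f` in `S`.
Since `F` is a `2`-functor, `F.mapId` and `F.mapComp` are identities. -/
structure SigmaCone (S : WideSub I) (F : StrictPseudofunctor I B) (E : B) where
  /-- The components `θ_i`. -/
  app (i : I) : F.obj i ⟶ E
  /-- The structural `2`-cells `θ_f`. -/
  cell {i j : I} (f : i ⟶ j) : F.map f ≫ app j ⟶ app i
  cell_naturality {i j : I} {f g : i ⟶ j} (η : f ⟶ g) :
    F.map₂ η ▷ app j ≫ cell g = cell f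
  cell_id (i : I) : cell (𝟙 i) = (F.mapId i).hom ▷ app i ≫ (λ_ (app i)).hom
  cell_comp {i j k : I} (f : i ⟶ j) (g : j ⟶ k) :
    cell (f ≫ g) = (F.mapComp f g).hom ▷ app k ≫ (α_ _ _ _).hom ≫ F.map f ◁ cell g ≫ cell f
  isIso_cell {i j : I} (f : i ⟶ j) : S.mem f → IsIso (cell f)

namespace SigmaCone

variable {S : WideSub I} {F : StrictPseudofunctor I B} {E : B}

/-- Morphisms of `σ`-cones: all the morphisms of the underlying lax cones. -/
@[ext]
structure Hom (θ θ' : SigmaCone S F E) where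
  /-- The components of the morphism. -/
  app (i : I) : θ.app i ⟶ θ'.app i
  w {i j : I} (f : i ⟶ j) : F.map f ◁ app j ≫ θ'.cell f = θ.cell f ≫ app i

/-- The category of `σ`-cones for `F` with vertex `E`. -/
instance : Category (SigmaCone S F E) where
  Hom := Hom
  id θ := { app := fun i => 𝟙 (θ.app i), w := by intros; simp }
  comp ρ τ := { app := fun i => ρ.app i ≫ τ.app i, w := fun f => by
                  rw [Bicategory.whiskerLeft_comp, Category.assoc, τ.w, ← Category.assoc, ρ.w,
                    Category.assoc] }
  id_comp _ := by apply Hom.ext; funext i; exact Category.id_comp _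
  comp_id _ := by apply Hom.ext; funext i; exact Category.comp_id _
  assoc _ _ _ := by apply Hom.ext; funext i; exact Category.assoc _ _ _

/-- Precomposition with the `σ`-cone `lam`, as a functor from `B(L, E)` to the category of `σ`-cones
for `F` with vertex `E`. -/
def precomp {L : B} (lam : SigmaCone S F L) (E : B) : (L ⟶ E) ⥤ SigmaCone S F E where
  obj g :=
    { app := fun i => lam.app i ≫ g
      cell := fun f => (α_ _ _ _).inv ≫ lam.cell f ▷ g
      cell_naturality := fun η => by
        rw [← lam.cell_naturality η]; simp
      cell_id := fun i => by
        rw [lam.cell_id]; simp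
      cell_comp := fun f g => by
        rw [lam.cell_comp]; simp
      isIso_cell := fun f hf => by
        have := lam.isIso_cell f hf
        infer_instance }
  map β :=
    { app := fun i => lam.app i ◁ β
      w := fun f => by
        simp [← whisker_exchange] }
  map_id g := by apply Hom.ext; funext i; exact whiskerLeft_id _ _
  map_comp β γ := by apply Hom.ext; funext i; exact whiskerLeft_comp _ _ _

end SigmaCone

/-- `lam` exhibits `L` as the conical `σ`-colimit of `F`: for every `E`, precomposition with `lam` is
an isomorphism of categories from `B(L, E)` to the `σ`-cones with vertex `E`. -/
def IsSigmaColimit {S : WideSub I} {F : StrictPseudofunctor I B} {L : B}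
    (lam : SigmaCone S F L) : Prop :=
  ∀ E : B, ∃ G : SigmaCone S F E ⥤ (L ⟶ E),
    lam.precomp E ⋙ G = 𝟭 _ ∧ G ⋙ lam.precomp E = 𝟭 _

/-- `lam` exhibits `L` as the conical `σ`-bicolimit of `F`: the same, with an equivalence of
categories. -/
def IsSigmaBicolimit {S : WideSub I} {F : StrictPseudofunctor I B} {L : B}
    (lam : SigmaCone S F L) : Prop :=
  ∀ E : B, (lam.precomp E).IsEquivalence

open Bicategory.Opposite

theorem op2_eqToHom {a b : B} {f g : a ⟶ b} (h : f = g) :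
    op2 (eqToHom h) = eqToHom (congrArg Quiver.Hom.op h) := by
  subst h; rfl

/-- The `2`-functor `F^op : I^op ⟶ B^op`. -/
def opTwoFunctor (F : StrictPseudofunctor I B) : StrictPseudofunctor Iᵒᵖ Bᵒᵖ where
  obj i := op (F.obj i.unop)
  map f := (F.map f.unop).op
  map₂ η := op2 (F.map₂ η.unop2)
  map₂_id f := by simp
  map₂_comp η θ := by simp
  mapId i := (F.mapId i.unop).op2
  mapComp f g := (F.mapComp g.unop f.unop).op2
  map₂_whisker_left f _ _ η := congrArg op2 (F.map₂_whisker_right η.unop2 f.unop)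
  map₂_whisker_right η f := congrArg op2 (F.map₂_whisker_left f.unop η.unop2)
  map₂_associator f g h := by
    refine congrArg op2 (?_ : F.map₂ (α_ h.unop g.unop f.unop).inv = _)
    have := F.mapComp_assoc_right_hom h.unop g.unop f.unop
    simp [reassoc_of% this]
  map₂_left_unitor f := congrArg op2 (F.map₂_right_unitor f.unop)
  map₂_right_unitor f := congrArg op2 (F.map₂_left_unitor f.unop)
  map_id i := congrArg Quiver.Hom.op (F.map_id i.unop)
  map_comp f g := congrArg Quiver.Hom.op (F.map_comp g.unop f.unop)
  mapId_eq_eqToIso i := by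
    ext
    have := F.mapId_eq_eqToIso i.unop
    simpa [this] using op2_eqToHom _
  mapComp_eq_eqToIso f g := by
    ext
    simpa [F.mapComp_eq_eqToIso] using op2_eqToHom _

end General

section Elements

variable {A : Type u} [Bicategory.{w, v} A] (P : StrictPseudofunctor A Cat.{w₁, v₁})

/-- Objects of the `2`-category of elements of `P`: pairs `(x, A)` with `x` an object of `P A`. -/
structure El where
  /-- The object `A`. -/
  base : A
  /-- The object `x` of `P A`. -/
  pt : P.obj base

namespace El
variable {P}

/-- Arrows `(x, A) ⟶ (y, B)`: pairs `(f, φ)` with `f : A ⟶ B` and `φ : P f x ⟶ y`. -/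
@[ext]
structure Hom (X Y : El P) where
  /-- The arrow `f`. -/
  base : X.base ⟶ Y.base
  /-- The arrow `φ`. -/
  fib : (P.map base).toFunctor.obj X.pt ⟶ Y.pt

/-- `(g, ψ) ∘ (f, φ) = (g f, ψ ∘ P g φ)`. -/
@[simps]
instance : CategoryStruct (El P) where
  Hom := Hom
  id X := { base := 𝟙 X.base, fib := (P.mapId X.base).hom.toNatTrans.app X.pt }
  comp f g :=
    { base := f.base ≫ g.base
      fib := (P.mapComp f.base g.base).hom.toNatTrans.app _ ≫
        (P.map g.base).toFunctor.map f.fib ≫ g.fib }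

/-- `2`-cells `(f, φ) ⟹ (g, ψ)`: `2`-cells `θ : f ⟹ g` with `ψ ∘ (P θ)_x = φ`. -/
@[ext]
structure Hom₂ {X Y : El P} (f g : X ⟶ Y) where
  /-- The `2`-cell `θ`. -/
  cell : f.base ⟶ g.base
  w : (P.map₂ cell).toNatTrans.app X.pt ≫ g.fib = f.fib

@[simps]
instance (X Y : El P) : Category (X ⟶ Y) where
  Hom f g := Hom₂ f g
  id f := { cell := 𝟙 f.base, w := by simp }
  comp α β := { cell := α.cell ≫ β.cell, w := by simp [Hom₂.w] }

@[ext]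
theorem hom₂_ext {X Y : El P} {f g : X ⟶ Y} {α β : f ⟶ g} (h : α.cell = β.cell) : α = β :=
  Hom₂.ext h

/-- Invertible `2`-cells of `El P` from invertible `2`-cells of `A`. -/
def isoMk {X Y : El P} {f g : X ⟶ Y} (e : f.base ≅ g.base)
    (h : (P.map₂ e.hom).toNatTrans.app X.pt ≫ g.fib = f.fib) : f ≅ g where
  hom := { cell := e.hom, w := h }
  inv :=
    { cell := e.inv
      w := by rw [← h, ← Category.assoc, ← Cat.Hom₂.comp_app, ← P.map₂_comp]; simp }
  hom_inv_id := by ext; simp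
  inv_hom_id := by ext; simp


/-- Left whiskering, computed in `A`. -/
def whiskerL {X Y Z : El P} (f : X ⟶ Y) {g h : Y ⟶ Z} (η : g ⟶ h) : f ≫ g ⟶ f ≫ h :=
  Hom₂.mk (f.base ◁ η.cell) (by
    simp [← Hom₂.w η])

/-- Right whiskering, computed in `A`. -/
def whiskerR {X Y Z : El P} {f g : X ⟶ Y} (η : f ⟶ g) (h : Y ⟶ Z) : f ≫ h ⟶ g ≫ h :=
  Hom₂.mk (η.cell ▷ h.base) (by
    simp [← Hom₂.w η])

/-- The associator, computed in `A` (an identity when `A` is strict). -/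
def assocIso {X Y Z W : El P} (f : X ⟶ Y) (g : Y ⟶ Z) (h : Z ⟶ W) :
    (f ≫ g) ≫ h ≅ f ≫ g ≫ h :=
  isoMk (α_ f.base g.base h.base) (by
    simp)

/-- The left unitor, computed in `A`. -/
def leftUnitorIso {X Y : El P} (f : X ⟶ Y) : 𝟙 X ≫ f ≅ f :=
  isoMk (λ_ f.base) (by simp)

/-- The right unitor, computed in `A`. -/
def rightUnitorIso {X Y : El P} (f : X ⟶ Y) : f ≫ 𝟙 Y ≅ f :=
  isoMk (ρ_ f.base) (by simp)

/-- The `2`-category of elements `El P`; all operations on `2`-cells are those of `A`. -/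
instance : Bicategory (El P) where
  whiskerLeft f _ _ η := whiskerL f η
  whiskerRight η h := whiskerR η h
  associator := assocIso
  leftUnitor := leftUnitorIso
  rightUnitor := rightUnitorIso
  whisker_exchange η θ := by ext; exact whisker_exchange _ _
  whiskerLeft_id _ _ := by ext; exact Bicategory.whiskerLeft_id _ _
  whiskerLeft_comp _ _ _ _ _ _ := by ext; exact Bicategory.whiskerLeft_comp _ _ _
  id_whiskerLeft _ := by ext; exact Bicategory.id_whiskerLeft _
  comp_whiskerLeft _ _ _ _ _ := by ext; exact Bicategory.comp_whiskerLeft _ _ _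
  id_whiskerRight _ _ := by ext; exact Bicategory.id_whiskerRight _ _
  comp_whiskerRight _ _ _ := by ext; exact Bicategory.comp_whiskerRight _ _ _
  whiskerRight_id _ := by ext; exact Bicategory.whiskerRight_id _
  whiskerRight_comp _ _ _ := by ext; exact Bicategory.whiskerRight_comp _ _ _
  whisker_assoc _ _ _ _ _ := by ext; exact Bicategory.whisker_assoc _ _ _
  pentagon _ _ _ _ := by ext; exact Bicategory.pentagon _ _ _ _
  triangle _ _ := by ext; exact Bicategory.triangle _ _


theorem eq_of_iso {X Y : El P} {f g : X ⟶ Y} (e : f ≅ g) (h : f.base = g.base)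
    (he : e.hom.cell = eqToHom h) : f = g := by
  obtain ⟨f₁, f₂⟩ := f
  obtain ⟨g₁, g₂⟩ := g
  dsimp at h
  subst h
  have := e.hom.w
  rw [he] at this
  simp at this
  rw [this]

theorem eqToIso_cell {X Y : El P} {f g : X ⟶ Y} (h : f = g) :
    (eqToIso h).hom.cell = eqToHom (congrArg Hom.base h) := by
  subst h; rfl

instance [Strict A] : Strict (El P) where
  id_comp f := eq_of_iso (λ_ f) (Strict.id_comp f.base)
    (congrArg Iso.hom (Strict.leftUnitor_eqToIso f.base))
  comp_id f := eq_of_iso (ρ_ f) (Strict.comp_id f.base)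
    (congrArg Iso.hom (Strict.rightUnitor_eqToIso f.base))
  assoc f g h := eq_of_iso (α_ f g h) (Strict.assoc f.base g.base h.base)
    (congrArg Iso.hom (Strict.associator_eqToIso f.base g.base h.base))
  leftUnitor_eqToIso f := by
    apply Iso.ext; apply hom₂_ext
    refine Eq.trans ?_ (eqToIso_cell _).symm
    exact (congrArg Iso.hom (Strict.leftUnitor_eqToIso f.base))
  rightUnitor_eqToIso f := by
    apply Iso.ext; apply hom₂_ext
    refine Eq.trans ?_ (eqToIso_cell _).symm
    exact (congrArg Iso.hom (Strict.rightUnitor_eqToIso f.base))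
  associator_eqToIso f g h := by
    apply Iso.ext; apply hom₂_ext
    refine Eq.trans ?_ (eqToIso_cell _).symm
    exact (congrArg Iso.hom (Strict.associator_eqToIso f.base g.base h.base))

variable (P) in
/-- The projection `2`-functor `El P ⟶ A`. -/
def proj : StrictPseudofunctor (El P) A where
  obj X := X.base
  map f := f.base
  map₂ α := α.cell
  mapId X := Iso.refl _
  mapComp f g := Iso.refl _
  map₂_whisker_left f _ _ η := by simp; rfl
  map₂_whisker_right η f := by simp; rfl
  map₂_associator f g h := by simp; rfl
  map₂_left_unitor f := by simp; rfl
  map₂_right_unitor f := by simp; rfl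

variable (P) in
/-- The `1`-subcategory `Cart_P` of `El P`: the arrows `(f, φ)` with `φ` invertible. -/
def cart : WideSub (El P) where
  mem _ _ f := IsIso f.fib
  id_mem X := by dsimp; infer_instance
  comp_mem _ _ _ f g hf hg := by dsimp; infer_instance

end El
end Elements

section Hom

/-- The `2`-category `Hom_p(A, C)` of `2`-functors, pseudonatural transformations and
modifications: the full sub-bicategory of Mathlib's bicategory of pseudofunctors on the
`2`-functors. -/
abbrev HomP (A : Type u₁) [Bicategory.{w₁, v₁} A] (C : Type u₂) [Bicategory.{w₂, v₂} C] :=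
  InducedBicategory (A ⥤ᵖ C) (fun F : StrictPseudofunctor A C => F.toPseudofunctor)


/-- A `2`-functor, as an object of `Hom_p(A, C)`. -/
def HomP.of {A : Type u₁} [Bicategory.{w₁, v₁} A] {C : Type u₂} [Bicategory.{w₂, v₂} C]
    (F : StrictPseudofunctor A C) : HomP A C :=
  F

variable {A : Type u} [Bicategory.{w, v} A]

theorem cat_ext₂ {C D : Cat.{w, v}} {F G : C ⟶ D} {α β : F ⟶ G}
    (h : ∀ x, α.toNatTrans.app x = β.toNatTrans.app x) : α = β :=
  Cat.Hom₂.ext (NatTrans.ext (funext h))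


theorem cat_eq {C D : Cat.{w, v}} {F G : C ⟶ D} (e : F ≅ G)
    (h : ∀ x, F.toFunctor.obj x = G.toFunctor.obj x)
    (he : ∀ x, e.hom.toNatTrans.app x = eqToHom (h x)) : F = G := by
  apply Cat.ext
  refine CategoryTheory.Functor.ext h fun x y f => ?_
  have := e.hom.toNatTrans.naturality f
  rw [he, he] at this
  rw [← reassoc_of% this]; simp

theorem cat_eqToIso {C D : Cat.{w, v}} {F G : C ⟶ D} (e : F ≅ G)
    (h : ∀ x, F.toFunctor.obj x = G.toFunctor.obj x)
    (he : ∀ x, e.hom.toNatTrans.app x = eqToHom (h x)) (hFG : F = G) : e = eqToIso hFG := by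
  apply Iso.ext; apply cat_ext₂; intro x
  rw [he, eqToIso.hom, Cat.eqToHom_app]

theorem strong_eq {C : Type u₂} [Bicategory.{w₂, v₂} C] {F G : A ⥤ᵖ C} {s t : F ⟶ G} (e : s ≅ t)
    (h : ∀ a, s.app a = t.app a) (he : ∀ a, e.hom.as.app a = eqToHom (h a)) : s = t := by
  obtain ⟨s₁, s₂, _, _, _⟩ := s
  obtain ⟨t₁, t₂, _, _, _⟩ := t
  obtain rfl : s₁ = t₁ := funext h
  have : @s₂ = @t₂ := by
    funext a b f
    have := e.hom.as.naturality f
    rw [he, he] at this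
    ext
    simpa using this.symm
  subst this
  rfl

theorem strong_eqToHom {C : Type u₂} [Bicategory.{w₂, v₂} C] {F G : A ⥤ᵖ C} {s t : F ⟶ G}
    (h : s = t) (a : A) :
    (eqToHom h).as.app a = eqToHom (congrArg (fun r : F ⟶ G => r.app a) h) := by
  subst h; rfl

theorem homP_eq {C : Type u₂} [Bicategory.{w₂, v₂} C] {F G : HomP A C} {s t : F ⟶ G} (e : s ≅ t)
    (h : ∀ a, s.hom.app a = t.hom.app a) (he : ∀ a, e.hom.hom.as.app a = eqToHom (h a)) :
    s = t :=
  InducedBicategory.hom_ext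
    (strong_eq ⟨e.hom.hom, e.inv.hom, congrArg InducedBicategory.Hom₂.hom e.hom_inv_id,
      congrArg InducedBicategory.Hom₂.hom e.inv_hom_id⟩ h he)

theorem homP_eqToIso {C : Type u₂} [Bicategory.{w₂, v₂} C] {F G : HomP A C} {s t : F ⟶ G}
    (e : s ≅ t)
    (h : ∀ a, s.hom.app a = t.hom.app a) (he : ∀ a, e.hom.hom.as.app a = eqToHom (h a))
    (hst : s = t) : e = eqToIso hst := by
  apply Iso.ext; apply InducedBicategory.hom₂_ext
  apply Pseudofunctor.StrongTrans.homCategory.ext; intro a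
  rw [he, eqToIso.hom, InducedBicategory.eqToHom_hom, strong_eqToHom]

theorem homP_ext₂ {F G : HomP A Cat.{w₁, v₁}} {s t : F ⟶ G} {α β : s ⟶ t}
    (h : ∀ c x, (α.hom.as.app c).toNatTrans.app x = (β.hom.as.app c).toNatTrans.app x) : α = β := by
  apply InducedBicategory.hom₂_ext
  apply Pseudofunctor.StrongTrans.homCategory.ext; intro a
  exact cat_ext₂ (h a)

variable [Strict A]

/-- The representable `2`-functor `A(a, -)`. -/
def rep (a : A) : StrictPseudofunctor A Cat.{w, v} where
  obj b := Cat.of (a ⟶ b)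
  map g := (postcomposingCat a _ _).obj g
  map₂ β := (postcomposingCat a _ _).map β
  mapId b := rightUnitorNatIsoCat a b
  mapComp f g := (associatorNatIsoLeftCat a f g).symm
  map₂_whisker_left f _ _ η := by
    apply cat_ext₂; intro (x : a ⟶ _)
    change x ◁ (f ◁ η) = (α_ x f _).inv ≫ (x ≫ f) ◁ η ≫ (α_ x f _).hom
    simp
  map₂_whisker_right η h := by
    apply cat_ext₂; intro (x : a ⟶ _)
    change x ◁ (η ▷ h) = (α_ x _ h).inv ≫ (x ◁ η) ▷ h ≫ (α_ x _ h).hom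
    simp
  map₂_associator f g h := by
    apply cat_ext₂; intro (x : a ⟶ _)
    change x ◁ (α_ f g h).hom = (α_ x (f ≫ g) h).inv ≫ (α_ x f g).inv ▷ h ≫ 𝟙 _ ≫
      (α_ (x ≫ f) g h).hom ≫ (α_ x f (g ≫ h)).hom
    simp
  map₂_left_unitor f := by
    apply cat_ext₂; intro (x : a ⟶ _)
    change x ◁ (λ_ f).hom = (α_ x (𝟙 _) f).inv ≫ (ρ_ x).hom ▷ f ≫ 𝟙 _
    simp
  map₂_right_unitor f := by
    apply cat_ext₂; intro (x : a ⟶ _)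
    change x ◁ (ρ_ f).hom = (α_ x f (𝟙 _)).inv ≫ (ρ_ (x ≫ f)).hom ≫ 𝟙 _
    simp
  map_id b := cat_eq (rightUnitorNatIsoCat a b) (fun x => Strict.comp_id (B := A) (a := a) x)
    fun x => congrArg Iso.hom (Strict.rightUnitor_eqToIso (B := A) (a := a) x)
  map_comp f g := cat_eq (associatorNatIsoLeftCat a f g).symm
    (fun x => (Strict.assoc (B := A) (a := a) x f g).symm)
    fun x => congrArg Iso.inv (Strict.associator_eqToIso (B := A) (a := a) x f g)
  mapId_eq_eqToIso b := cat_eqToIso _ (fun x => Strict.comp_id (B := A) (a := a) x)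
    (fun x => congrArg Iso.hom (Strict.rightUnitor_eqToIso (B := A) (a := a) x)) _
  mapComp_eq_eqToIso f g := cat_eqToIso _
    (fun x => (Strict.assoc (B := A) (a := a) x f g).symm)
    (fun x => congrArg Iso.inv (Strict.associator_eqToIso (B := A) (a := a) x f g)) _

/-- Precomposition with `f : a ⟶ b`, as a (strictly natural) transformation
`A(b, -) ⟶ A(a, -)`. -/
def repMap {a b : A} (f : a ⟶ b) : (rep b).toPseudofunctor ⟶ (rep a).toPseudofunctor where
  app c := (precomposingCat a b c).obj f
  naturality g := (associatorNatIsoMiddleCat f g).symm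
  naturality_naturality η := by
    apply cat_ext₂; intro (x : b ⟶ _)
    change f ◁ (x ◁ η) ≫ (α_ f x _).inv = (α_ f x _).inv ≫ (f ≫ x) ◁ η
    simp
  naturality_id c := by
    apply cat_ext₂; intro (x : b ⟶ _)
    change (α_ f x _).inv ≫ (ρ_ (f ≫ x)).hom = f ◁ (ρ_ x).hom ≫ 𝟙 _ ≫ 𝟙 _
    simp
  naturality_comp g h := by
    apply cat_ext₂; intro (x : b ⟶ _)
    change (α_ f x _).inv ≫ (α_ (f ≫ x) g h).inv = f ◁ (α_ x g h).inv ≫ 𝟙 _ ≫ (α_ f (x ≫ g) h).inv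
      ≫ 𝟙 _ ≫ (α_ f x g).inv ▷ h ≫ 𝟙 _
    simp

/-- Precomposition with a `2`-cell. -/
def repMap₂ {a b : A} {f g : a ⟶ b} (η : f ⟶ g) : repMap f ⟶ repMap g where
  as :=
    { app := fun c => (precomposingCat a b c).map η
      naturality := fun h => by
        apply cat_ext₂; intro (x : b ⟶ _)
        change η ▷ (x ≫ h) ≫ (α_ g x h).inv = (α_ f x h).inv ≫ (η ▷ x) ▷ h
        simp }


open Bicategory.Opposite InducedBicategory

/-- Precomposition with an identity is the identity. -/
def repMapId (a : A) : repMap (𝟙 a) ≅ 𝟙 (rep a).toPseudofunctor :=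
  Pseudofunctor.StrongTrans.isoMk (fun b => leftUnitorNatIsoCat a b) fun h => by
    apply cat_ext₂; intro (x : a ⟶ _)
    change (λ_ (x ≫ h)).hom ≫ 𝟙 _ ≫ 𝟙 _ = (α_ (𝟙 a) x h).inv ≫ (λ_ x).hom ▷ h
    simp

/-- Precomposition with a composite. -/
def repMapComp {a b c : A} (f : a ⟶ b) (g : b ⟶ c) : repMap (f ≫ g) ≅ repMap g ≫ repMap f :=
  Pseudofunctor.StrongTrans.isoMk (fun d => associatorNatIsoRightCat f g d) fun h => by
    apply cat_ext₂; intro (x : c ⟶ _)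
    change (α_ f g (x ≫ h)).hom ≫ 𝟙 _ ≫ f ◁ (α_ g x h).inv ≫ 𝟙 _ ≫ (α_ f (g ≫ x) h).inv ≫ 𝟙 _ =
      (α_ (f ≫ g) x h).inv ≫ (α_ f g x).hom ▷ h
    simp

theorem leftUnitorCat_eq (a b : A) : (precomposingCat a a b).obj (𝟙 a) = 𝟙 (Cat.of (a ⟶ b)) :=
  cat_eq (leftUnitorNatIsoCat a b) (fun x => Strict.id_comp (B := A) (a := a) (b := b) x)
    fun x => congrArg Iso.hom (Strict.leftUnitor_eqToIso (B := A) (a := a) (b := b) x)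

theorem leftUnitorCat_eqToIso (a b : A) :
    leftUnitorNatIsoCat a b = eqToIso (leftUnitorCat_eq a b) :=
  cat_eqToIso _ (fun x => Strict.id_comp (B := A) (a := a) (b := b) x)
    (fun x => congrArg Iso.hom (Strict.leftUnitor_eqToIso (B := A) (a := a) (b := b) x)) _

theorem associatorCat_eq {a b c : A} (f : a ⟶ b) (g : b ⟶ c) (d : A) :
    (precomposingCat a c d).obj (f ≫ g) =
      (precomposingCat b c d).obj g ≫ (precomposingCat a b d).obj f :=
  cat_eq (associatorNatIsoRightCat f g d) (fun x => Strict.assoc (B := A) (d := d) f g x)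
    fun x => congrArg Iso.hom (Strict.associator_eqToIso (B := A) (d := d) f g x)

theorem associatorCat_eqToIso {a b c : A} (f : a ⟶ b) (g : b ⟶ c) (d : A) :
    associatorNatIsoRightCat f g d = eqToIso (associatorCat_eq f g d) :=
  cat_eqToIso _ (fun x => Strict.assoc (B := A) (d := d) f g x)
    (fun x => congrArg Iso.hom (Strict.associator_eqToIso (B := A) (d := d) f g x)) _

/-- The Yoneda `2`-functor `h : A^op ⟶ Hom_p(A, Cat)`, `h a = A(a, -)`. -/
def yonedaOp (A : Type u) [Bicategory.{w, v} A] [Strict A] :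
    StrictPseudofunctor Aᵒᵖ (HomP A Cat.{w, v}) where
  obj a := rep a.unop
  map f := mkHom (repMap f.unop)
  map₂ η := mkHom₂ (repMap₂ η.unop2)
  map₂_id f := by
    apply homP_ext₂; intro c (x : _ ⟶ c)
    change 𝟙 f.unop ▷ x = 𝟙 _
    simp
  map₂_comp η θ := by
    apply homP_ext₂; intro c (x : _ ⟶ c)
    change (η.unop2 ≫ θ.unop2) ▷ x = η.unop2 ▷ x ≫ θ.unop2 ▷ x
    simp
  mapId a := InducedBicategory.isoMk (repMapId a.unop)
  mapComp f g := InducedBicategory.isoMk (repMapComp g.unop f.unop)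
  map₂_whisker_left f g h η := by
    apply homP_ext₂; intro c (x : _ ⟶ c)
    change (η.unop2 ▷ f.unop) ▷ x = (α_ g.unop f.unop x).hom ≫ η.unop2 ▷ (f.unop ≫ x) ≫
      (α_ h.unop f.unop x).inv
    simp
  map₂_whisker_right {_ _ _ f g} η h := by
    apply homP_ext₂; intro c (x : _ ⟶ c)
    change (h.unop ◁ η.unop2) ▷ x = (α_ h.unop f.unop x).hom ≫ h.unop ◁ (η.unop2 ▷ x) ≫
      (α_ h.unop g.unop x).inv
    simp
  map₂_associator f g h := by
    apply homP_ext₂; intro c (x : _ ⟶ c)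
    change (α_ h.unop g.unop f.unop).inv ▷ x = (α_ h.unop (g.unop ≫ f.unop) x).hom ≫
      h.unop ◁ (α_ g.unop f.unop x).hom ≫ 𝟙 _ ≫ (α_ h.unop g.unop (f.unop ≫ x)).inv ≫
      (α_ (h.unop ≫ g.unop) f.unop x).inv
    simp
  map₂_left_unitor f := by
    apply homP_ext₂; intro c (x : _ ⟶ c)
    change (ρ_ f.unop).hom ▷ x = (α_ f.unop (𝟙 _) x).hom ≫ f.unop ◁ (λ_ x).hom ≫ 𝟙 _
    simp
  map₂_right_unitor f := by
    apply homP_ext₂; intro c (x : _ ⟶ c)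
    change (λ_ f.unop).hom ▷ x = (α_ (𝟙 _) f.unop x).hom ≫ (λ_ (f.unop ≫ x)).hom ≫ 𝟙 _
    simp
  map_id a := homP_eq (InducedBicategory.isoMk (repMapId a.unop)) (leftUnitorCat_eq a.unop)
    fun b => congrArg Iso.hom (leftUnitorCat_eqToIso a.unop b)
  map_comp f g := homP_eq (InducedBicategory.isoMk (repMapComp g.unop f.unop))
    (associatorCat_eq g.unop f.unop)
    fun d => congrArg Iso.hom (associatorCat_eqToIso g.unop f.unop d)
  mapId_eq_eqToIso a := homP_eqToIso _ (leftUnitorCat_eq a.unop)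
    (fun b => congrArg Iso.hom (leftUnitorCat_eqToIso a.unop b)) _
  mapComp_eq_eqToIso f g := homP_eqToIso _ (associatorCat_eq g.unop f.unop)
    (fun d => congrArg Iso.hom (associatorCat_eqToIso g.unop f.unop d)) _

end Hom

section Main

variable {A : Type u} [Bicategory.{w, v} A] [Strict A]

/-- The diagram `El_P^op ⟶ A^op ⟶ Hom_p(A, Cat)`, `(x, a) ↦ A(a, -)`. -/
def repDiagram (P : StrictPseudofunctor A Cat.{w, v}) :
    StrictPseudofunctor (El P)ᵒᵖ (HomP A Cat.{w, v}) :=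
  (opTwoFunctor (El.proj P)).comp (yonedaOp A)

end Main

end TwoCat

/-! A σ-cone θ with vertex Q gives, for x in P a and g : a ⟶ c, an object θ_(x,a)(g) of Q c, and for
(f, φ) : (x, a) ⟶ (y, b) maps θ_(x,a)(f ≫ g) ⟶ θ_(y,b)(g). The arrow (g, 1) : (x, a) ⟶ (P g x, c) is
cartesian, so θ_(x,a)(g) ≅ θ_(P g x, c)(1): up to isomorphism the cone is determined by the objects
θ_(y,c)(1) with y in P c. The arrows (1, u) make y ↦ θ_(y,c)(1) functorial and the naturality of the
legs makes it pseudonatural (`ofCone`). This is a Yoneda argument: every cone is isomorphic to a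
composite of the cone `pointCone`, whose legs are g ↦ P g x (`isoOfCone`). In the same way a
morphism between composite cones is determined by its components at the identities, which form a
modification (`coneHomApp_comp_map`, `map_ofConeHom`, `precomp_pointCone_injective`). Hence P is a
σ-bicolimit, which is (3). Since a σ-colimit is a σ-bicolimit, and σ-bicolimits are unique up to
equivalence, (1) follows.

In general P need not be a strict σ-colimit: a composite with `pointCone` has equal values at (x, g)
and (P g x, 1), where a general cone only has isomorphic ones. For (2), P is replaced by an
equivalent 2-functor that remembers the pair: its objects at c are the pairs ((x, a), g : a ⟶ c),
and its morphisms are those of P c between the objects P g x. Smallness of A keeps this inside the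
given universe, and strictness of A and P makes it a 2-functor. The transported cone is again a
σ-bicolimit. Its legs hit each object of the vertex exactly once, so the values of a cone are
precisely the object values of a transformation out of the vertex. Precomposition is therefore
bijective on objects as well as fully faithful, hence an isomorphism of categories. -/

namespace TwoCat

/-! ### Cat-valued pseudonatural transformations and modifications in components -/

section Components

variable {A : Type u} [Bicategory.{w, v} A] {P Q : A ⥤ᵖ Cat.{w₁, v₁}}

/-- The components of the naturality isomorphisms of a pseudonatural transformation. -/
def natIso (s : P ⟶ Q) {c d : A} (h : c ⟶ d) (x : P.obj c) :
    (s.app d).toFunctor.obj ((P.map h).toFunctor.obj x) ≅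
      (Q.map h).toFunctor.obj ((s.app c).toFunctor.obj x) :=
  (Cat.Hom.toNatIso (s.naturality h)).app x

section

variable (s : P ⟶ Q)

theorem natIso_natural {c d : A} (h : c ⟶ d) {x y : P.obj c} (u : x ⟶ y) :
    (s.app d).toFunctor.map ((P.map h).toFunctor.map u) ≫ (natIso s h y).hom =
      (natIso s h x).hom ≫ (Q.map h).toFunctor.map ((s.app c).toFunctor.map u) :=
  (s.naturality h).hom.toNatTrans.naturality u

theorem natIso_map₂ {c d : A} {h k : c ⟶ d} (η : h ⟶ k) (x : P.obj c) :
    (s.app d).toFunctor.map ((P.map₂ η).toNatTrans.app x) ≫ (natIso s k x).hom =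
      (natIso s h x).hom ≫ (Q.map₂ η).toNatTrans.app ((s.app c).toFunctor.obj x) :=
  congrArg (fun t => t.toNatTrans.app x) (s.naturality_naturality η)

theorem natIso_id (c : A) (x : P.obj c) :
    (natIso s (𝟙 c) x).hom ≫ (Q.mapId c).hom.toNatTrans.app ((s.app c).toFunctor.obj x) =
      (s.app c).toFunctor.map ((P.mapId c).hom.toNatTrans.app x) := by
  have := congrArg (fun t => t.toNatTrans.app x) (s.naturality_id c)
  refine this.trans ?_
  -- The two identities are components of unitors of `Cat`.
  change _ ≫ 𝟙 _ ≫ 𝟙 _ = _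
  rw [Category.comp_id, Category.comp_id]
  rfl

theorem natIso_comp {c d e : A} (h : c ⟶ d) (k : d ⟶ e) (x : P.obj c) :
    (natIso s (h ≫ k) x).hom ≫
        (Q.mapComp h k).hom.toNatTrans.app ((s.app c).toFunctor.obj x) =
      (s.app e).toFunctor.map ((P.mapComp h k).hom.toNatTrans.app x) ≫
        (natIso s k ((P.map h).toFunctor.obj x)).hom ≫
          (Q.map k).toFunctor.map (natIso s h x).hom := by
  have := congrArg (fun t => t.toNatTrans.app x) (s.naturality_comp h k)
  refine this.trans ?_
  -- The identities are components of associators of `Cat`.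
  change _ ≫ 𝟙 _ ≫ _ ≫ 𝟙 _ ≫ _ ≫ 𝟙 _ = _
  rw [Category.comp_id, Category.id_comp, Category.id_comp]
  rfl

end

/-- A pseudonatural transformation between `Cat`-valued pseudofunctors, from its components. -/
def mkTrans (o : ∀ c, P.obj c → Q.obj c) (F : ∀ c {x y : P.obj c}, (x ⟶ y) → (o c x ⟶ o c y))
    (n : ∀ {c d : A} (h : c ⟶ d) (x : P.obj c), o d ((P.map h).toFunctor.obj x) ≅
      (Q.map h).toFunctor.obj (o c x))
    (F_id : ∀ c (x : P.obj c), F c (𝟙 x) = 𝟙 (o c x))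
    (F_comp : ∀ c {x y z : P.obj c} (u : x ⟶ y) (v : y ⟶ z), F c (u ≫ v) = F c u ≫ F c v)
    (hn : ∀ {c d : A} (h : c ⟶ d) {x y : P.obj c} (u : x ⟶ y),
      F d ((P.map h).toFunctor.map u) ≫ (n h y).hom =
        (n h x).hom ≫ (Q.map h).toFunctor.map (F c u))
    (hm : ∀ {c d : A} {h k : c ⟶ d} (η : h ⟶ k) (x : P.obj c),
      F d ((P.map₂ η).toNatTrans.app x) ≫ (n k x).hom =
        (n h x).hom ≫ (Q.map₂ η).toNatTrans.app (o c x))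
    (hi : ∀ (c : A) (x : P.obj c),
      (n (𝟙 c) x).hom ≫ (Q.mapId c).hom.toNatTrans.app (o c x) =
        F c ((P.mapId c).hom.toNatTrans.app x))
    (hc : ∀ {c d e : A} (h : c ⟶ d) (k : d ⟶ e) (x : P.obj c),
      (n (h ≫ k) x).hom ≫ (Q.mapComp h k).hom.toNatTrans.app (o c x) =
        F e ((P.mapComp h k).hom.toNatTrans.app x) ≫
          (n k ((P.map h).toFunctor.obj x)).hom ≫ (Q.map k).toFunctor.map (n h x).hom) :
    P ⟶ Q where
  app c := Functor.toCatHom { obj := o c, map := F c, map_id := F_id c, map_comp := F_comp c }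
  naturality {c d} h := Cat.Hom.isoMk (F := (P.map h).toFunctor ⋙
        { obj := o d, map := F d, map_id := F_id d, map_comp := F_comp d })
    (G := { obj := o c, map := F c, map_id := F_id c, map_comp := F_comp c } ⋙
      (Q.map h).toFunctor) (NatIso.ofComponents (n h) (hn h))
  naturality_naturality η := cat_ext₂ (hm η)
  naturality_id c := cat_ext₂ fun x => by
    refine (hi c x).trans ?_
    change _ = _ ≫ 𝟙 _ ≫ 𝟙 _
    rw [Category.comp_id, Category.comp_id]
    rfl
  naturality_comp h k := cat_ext₂ fun x => by
    refine (hc h k x).trans ?_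
    change _ = _ ≫ 𝟙 _ ≫ _ ≫ 𝟙 _ ≫ _ ≫ 𝟙 _
    rw [Category.comp_id, Category.id_comp, Category.id_comp]
    rfl

theorem modif_natural {s t : P ⟶ Q} (m : s ⟶ t) {c d : A} (h : c ⟶ d) (x : P.obj c) :
    (m.as.app d).toNatTrans.app ((P.map h).toFunctor.obj x) ≫ (natIso t h x).hom =
      (natIso s h x).hom ≫ (Q.map h).toFunctor.map ((m.as.app c).toNatTrans.app x) :=
  congrArg (fun t => t.toNatTrans.app x) (m.as.naturality h)

/-- A modification, from its components. -/
def mkModif {s t : P ⟶ Q}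
    (m : ∀ c (x : P.obj c), (s.app c).toFunctor.obj x ⟶ (t.app c).toFunctor.obj x)
    (hm : ∀ c {x y : P.obj c} (u : x ⟶ y),
      (s.app c).toFunctor.map u ≫ m c y = m c x ≫ (t.app c).toFunctor.map u)
    (hn : ∀ {c d : A} (h : c ⟶ d) (x : P.obj c),
      m d ((P.map h).toFunctor.obj x) ≫ (natIso t h x).hom =
        (natIso s h x).hom ≫ (Q.map h).toFunctor.map (m c x)) : s ⟶ t where
  as :=
    { app := fun c => ⟨{ app := m c, naturality := fun _ _ u => hm c u }⟩
      naturality := fun h => cat_ext₂ (hn h) }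

theorem modif_ext {s t : P ⟶ Q} {m m' : s ⟶ t}
    (h : ∀ c x, (m.as.app c).toNatTrans.app x = (m'.as.app c).toNatTrans.app x) : m = m' :=
  Pseudofunctor.StrongTrans.homCategory.ext fun c => cat_ext₂ (h c)

/-- An invertible modification, from its components. -/
def mkModifIso {s t : P ⟶ Q}
    (m : ∀ c (x : P.obj c), (s.app c).toFunctor.obj x ≅ (t.app c).toFunctor.obj x)
    (hm : ∀ c {x y : P.obj c} (u : x ⟶ y),
      (s.app c).toFunctor.map u ≫ (m c y).hom = (m c x).hom ≫ (t.app c).toFunctor.map u)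
    (hn : ∀ {c d : A} (h : c ⟶ d) (x : P.obj c),
      (m d ((P.map h).toFunctor.obj x)).hom ≫ (natIso t h x).hom =
        (natIso s h x).hom ≫ (Q.map h).toFunctor.map (m c x).hom) : s ≅ t where
  hom := mkModif (fun c x => (m c x).hom) hm hn
  inv := mkModif (fun c x => (m c x).inv)
    (fun c x y u => by rw [Iso.comp_inv_eq, Category.assoc, hm, Iso.inv_hom_id_assoc])
    (fun h x => by
      rw [Iso.inv_comp_eq, ← Category.assoc, hn h x, Category.assoc,
        ← CategoryTheory.Functor.map_comp, Iso.hom_inv_id, CategoryTheory.Functor.map_id,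
        Category.comp_id])
  hom_inv_id := modif_ext fun c x => (m c x).hom_inv_id
  inv_hom_id := modif_ext fun c x => (m c x).inv_hom_id

/-- A pseudonatural transformation isomorphic to `s`, with prescribed values on objects. -/
def copyObj (s : P ⟶ Q) (o : ∀ c, P.obj c → Q.obj c)
    (e : ∀ c x, o c x ≅ (s.app c).toFunctor.obj x) : P ⟶ Q :=
  mkTrans o (fun c {x y} u => (e c x).hom ≫ (s.app c).toFunctor.map u ≫ (e c y).inv)
    (fun {c d} h x => e d _ ≪≫ natIso s h x ≪≫ (Q.map h).toFunctor.mapIso (e c x).symm)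
    (fun c x => by simp) (fun c u v => by simp)
    (fun h x y u => by simp [reassoc_of% @natIso_natural])
    (fun η x => by simp [reassoc_of% @natIso_map₂])
    (fun c x => by simp [← natIso_id])
    (fun h k x => by
      have := natIso_comp s h k x
      simp [reassoc_of% this])

/-- The copy is isomorphic to the original. -/
def copyObjIso (s : P ⟶ Q) (o : ∀ c, P.obj c → Q.obj c)
    (e : ∀ c x, o c x ≅ (s.app c).toFunctor.obj x) : copyObj s o e ≅ s :=
  mkModifIso e
    (fun c {x y} u => show ((e c x).hom ≫ (s.app c).toFunctor.map u ≫ (e c y).inv) ≫ (e c y).hom =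
        (e c x).hom ≫ (s.app c).toFunctor.map u by simp)
    (fun {c d} h x => show (e d _).hom ≫ (natIso s h x).hom =
        ((e d _).hom ≫ (natIso s h x).hom ≫ (Q.map h).toFunctor.map (e c x).inv) ≫
          (Q.map h).toFunctor.map (e c x).hom by
      simp [← CategoryTheory.Functor.map_comp])

end Components

/-! ### Formal properties of σ-cones, σ-colimits and σ-bicolimits -/

section Cones

variable {I : Type u₁} [Bicategory.{w₁, v₁} I] {B : Type u₂} [Bicategory.{w₂, v₂} B]
  {S : WideSub I} {F : StrictPseudofunctor I B} {E : B}

namespace SigmaCone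

theorem hom_ext {θ θ' : SigmaCone S F E} {f g : θ ⟶ θ'} (h : ∀ i, f.app i = g.app i) : f = g :=
  Hom.ext (funext h)

/-- An isomorphism of `σ`-cones from its components. -/
def isoMk {θ θ' : SigmaCone S F E} (e : ∀ i, θ.app i ≅ θ'.app i)
    (w : ∀ {i j : I} (f : i ⟶ j), F.map f ◁ (e j).hom ≫ θ'.cell f = θ.cell f ≫ (e i).hom) :
    θ ≅ θ' where
  hom := { app := fun i => (e i).hom, w := w }
  inv :=
    { app := fun i => (e i).inv
      w := fun {i j} f => by
        rw [← cancel_mono (e i).hom, Category.assoc, Category.assoc, ← w f]; simp }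
  hom_inv_id := hom_ext fun i => (e i).hom_inv_id
  inv_hom_id := hom_ext fun i => (e i).inv_hom_id

/-- The components of an isomorphism of `σ`-cones. -/
@[simps]
def appIso {θ θ' : SigmaCone S F E} (e : θ ≅ θ') (i : I) : θ.app i ≅ θ'.app i where
  hom := e.hom.app i
  inv := e.inv.app i
  hom_inv_id := congrArg (fun f : θ ⟶ θ => f.app i) e.hom_inv_id
  inv_hom_id := congrArg (fun f : θ' ⟶ θ' => f.app i) e.inv_hom_id

/-- A `σ`-cone isomorphic to `θ`, with prescribed components. -/
def copy (θ : SigmaCone S F E) (t : ∀ i, F.obj i ⟶ E) (e : ∀ i, t i ≅ θ.app i) :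
    SigmaCone S F E where
  app := t
  cell {i j} f := F.map f ◁ (e j).hom ≫ θ.cell f ≫ (e i).inv
  cell_naturality {i j f g} η := by
    rw [← θ.cell_naturality η, ← whisker_exchange_assoc]
    simp
  cell_id i := by
    rw [θ.cell_id, Category.assoc, whisker_exchange_assoc]
    simp
  cell_comp f g := by
    rw [θ.cell_comp, Category.assoc, whisker_exchange_assoc]
    simp
  isIso_cell f hf := by
    have := θ.isIso_cell f hf
    infer_instance

/-- The copy is isomorphic to the original. -/
def copyIso (θ : SigmaCone S F E) (t : ∀ i, F.obj i ⟶ E) (e : ∀ i, t i ≅ θ.app i) :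
    θ.copy t e ≅ θ :=
  isoMk e fun f => by simp [copy]

/-- Isomorphic `σ`-cones induce isomorphic functors. -/
def precompCongr {L : B} {θ θ' : SigmaCone S F L} (e : θ ≅ θ') (E : B) :
    θ.precomp E ≅ θ'.precomp E :=
  NatIso.ofComponents
    (fun g => isoMk (fun i => whiskerRightIso (appIso e i) g) fun {i j} f => by
      have := e.hom.w f
      simp only [precomp, whiskerRightIso_hom, appIso_hom, Category.assoc]
      rw [← comp_whiskerRight, ← this]
      simp)
    (fun β => hom_ext fun i => whisker_exchange (e.hom.app i) β)

/-- Precomposition with `θ` followed by `h`. -/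
def precompAssoc {L L' : B} (θ : SigmaCone S F L) (h : L ⟶ L') (E : B) :
    ((θ.precomp L').obj h).precomp E ≅ Bicategory.precomp E h ⋙ θ.precomp E :=
  NatIso.ofComponents
    (fun g => isoMk (fun i => α_ (θ.app i) h g) fun {i j} f =>
      show F.map f ◁ (α_ (θ.app j) h g).hom ≫ (α_ _ _ _).inv ≫ θ.cell f ▷ (h ≫ g) =
        ((α_ _ _ _).inv ≫ ((α_ _ _ _).inv ≫ θ.cell f ▷ h) ▷ g) ≫ (α_ (θ.app i) h g).hom by simp)
    (fun β => hom_ext fun i => by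
      change (θ.app i ≫ h) ◁ β ≫ (α_ _ _ _).hom = (α_ _ _ _).hom ≫ θ.app i ◁ (h ◁ β)
      simp)

/-- Precomposition of `θ` with an identity. -/
def precompId {L : B} (θ : SigmaCone S F L) : (θ.precomp L).obj (𝟙 L) ≅ θ :=
  isoMk (fun i => ρ_ (θ.app i)) fun f => by simp [precomp]

/-- A fully faithful functor that is bijective on objects has a strict inverse. -/
theorem _root_.CategoryTheory.Functor.FullyFaithful.exists_strict_inverse
    {C : Type u₁} [Category.{v₁} C] {D : Type u₂} [Category.{v₂} D] {F : C ⥤ D}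
    (hF : F.FullyFaithful) (ho : Function.Bijective F.obj) :
    ∃ G : D ⥤ C, F ⋙ G = 𝟭 C ∧ G ⋙ F = 𝟭 D := by
  let o : C ≃ D := Equiv.ofBijective F.obj ho
  have ho : ∀ d, F.obj (o.symm d) = d := o.apply_symm_apply
  let G : D ⥤ C :=
    { obj := o.symm
      map := fun {d d'} f => hF.preimage (eqToHom (ho d) ≫ f ≫ eqToHom (ho d').symm)
      map_id := fun d => hF.map_injective (by simp)
      map_comp := fun f g => hF.map_injective (by simp) }
  refine ⟨G, ?_, ?_⟩
  · refine CategoryTheory.Functor.ext o.symm_apply_apply fun c c' f => hF.map_injective ?_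
    simp only [G, Functor.comp_map, Functor.id_map, Functor.FullyFaithful.map_preimage,
      Functor.map_comp]
    exact (congrArg₂ (fun a b => a ≫ F.map f ≫ b) (eqToHom_map F _) (eqToHom_map F _)).symm
  · refine CategoryTheory.Functor.ext ho fun d d' f => ?_
    simp [G]

end SigmaCone

theorem IsSigmaColimit.isSigmaBicolimit {L : B} {lam : SigmaCone S F L}
    (h : IsSigmaColimit lam) : IsSigmaBicolimit lam := fun E => by
  obtain ⟨G, h₁, h₂⟩ := h E
  exact (CategoryTheory.Equivalence.mk (lam.precomp E) G (eqToIso h₁.symm)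
    (eqToIso h₂)).isEquivalence_functor

/-- A `σ`-bicolimit is a `σ`-colimit if precomposition is bijective on objects. -/
theorem IsSigmaBicolimit.isSigmaColimit {L : B} {lam : SigmaCone S F L}
    (h : IsSigmaBicolimit lam) (ho : ∀ E, Function.Bijective (lam.precomp E).obj) :
    IsSigmaColimit lam := fun E =>
  have := h E
  (Functor.FullyFaithful.ofFullyFaithful (lam.precomp E)).exists_strict_inverse (ho E)

/-- Two compatible factorizations of `σ`-bicolimits through each other compose to an identity. -/
theorem IsSigmaBicolimit.nonempty_comp_iso_id {L L' : B} {lam : SigmaCone S F L}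
    {mu : SigmaCone S F L'} (h : IsSigmaBicolimit lam) {f : L ⟶ L'} {g : L' ⟶ L}
    (hf : (lam.precomp L').obj f ≅ mu) (hg : (mu.precomp L).obj g ≅ lam) :
    Nonempty (f ≫ g ≅ 𝟙 L) :=
  have := h L
  -- Both `f ≫ g` and `𝟙 L` carry `lam` to a cone isomorphic to `lam`, and full faithfulness of
  -- precomposition lifts the resulting isomorphism of cones.
  ⟨(lam.precomp L).preimageIso (((lam.precompAssoc f L).app g).symm ≪≫
    (SigmaCone.precompCongr hf L).app g ≪≫ hg ≪≫ lam.precompId.symm)⟩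

/-- Vertices of `σ`-bicolimits are unique up to equivalence. -/
theorem IsSigmaBicolimit.nonempty_equivalence {L L' : B} {lam : SigmaCone S F L}
    {mu : SigmaCone S F L'} (h : IsSigmaBicolimit lam) (h' : IsSigmaBicolimit mu) :
    Nonempty (Bicategory.Equivalence L L') := by
  have := h L'
  have := h' L
  let hf := (lam.precomp L').objObjPreimageIso mu
  let hg := (mu.precomp L).objObjPreimageIso lam
  obtain ⟨η⟩ := h.nonempty_comp_iso_id hf hg
  obtain ⟨κ⟩ := h'.nonempty_comp_iso_id hg hf
  -- The two isomorphisms need not satisfy the triangle identities, so the counit is adjusted.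
  exact ⟨.mkOfAdjointifyCounit η.symm κ⟩

/-- Composing a `σ`-bicolimit with an equivalence, up to isomorphism, gives a `σ`-bicolimit. -/
theorem IsSigmaBicolimit.of_equivalence {L L' : B} {lam : SigmaCone S F L}
    {mu : SigmaCone S F L'} (h : IsSigmaBicolimit lam) {f : L ⟶ L'} {g : L' ⟶ L}
    (hfg : f ≫ g ≅ 𝟙 L) (hgf : g ≫ f ≅ 𝟙 L') (e : (lam.precomp L').obj f ≅ mu) :
    IsSigmaBicolimit mu := fun E => by
  have := h E
  let T : (L' ⟶ E) ≌ (L ⟶ E) := .mk (Bicategory.precomp E f) (Bicategory.precomp E g)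
    ((leftUnitorNatIso L' E).symm ≪≫ (precomposing L' L' E).mapIso hgf.symm ≪≫
      associatorNatIsoRight g f E)
    ((associatorNatIsoRight f g E).symm ≪≫ (precomposing L L E).mapIso hfg ≪≫
      leftUnitorNatIso L E)
  have : (Bicategory.precomp E f).IsEquivalence := T.isEquivalence_functor
  -- Up to isomorphism, `mu.precomp E` is precomposition with `f` followed by `lam.precomp E`, a
  -- composite of equivalences.
  exact Functor.isEquivalence_of_iso
    ((lam.precompAssoc f E).symm ≪≫ SigmaCone.precompCongr e E)

end Cones

/-- The pseudofunctor underlying an object of `HomP`. -/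
abbrev HomP.psd {A : Type u} [Bicategory.{w, v} A] (Q : HomP A Cat.{w₁, v₁}) :
    A ⥤ᵖ Cat.{w₁, v₁} :=
  StrictlyUnitaryPseudofunctor.toPseudofunctor
    (StrictPseudofunctor.toStrictlyUnitaryPseudofunctor Q)

/-! ### A σ-cone on the diagram of representables, in components -/

section ConeComponents

variable {A : Type u} [Bicategory.{w, v} A] [Strict A] {P : StrictPseudofunctor A Cat.{w, v}}
  {Q : HomP A Cat.{w, v}}

/-- An arrow of the `2`-category of elements. -/
abbrev El.arrow (X Y : El P) (f : X.base ⟶ Y.base)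
    (φ : (P.map f).toFunctor.obj X.pt ⟶ Y.pt) : X ⟶ Y := El.Hom.mk f φ

/-- The `2`-cell of the `2`-category of elements with a given target over a `2`-cell. -/
abbrev El.cellOf (X Y : El P) (f : X.base ⟶ Y.base)
    (φ : (P.map f).toFunctor.obj X.pt ⟶ Y.pt) {f' : X.base ⟶ Y.base} (η : f' ⟶ f) :
    El.arrow X Y f' ((P.map₂ η).toNatTrans.app X.pt ≫ φ) ⟶ El.arrow X Y f φ :=
  El.Hom₂.mk η rfl

variable (θ : SigmaCone (El.cart P).op (repDiagram P) Q)

/-- The pseudonatural transformation `A(a, -) ⟶ Q` at `(x, a)` given by a `σ`-cone. -/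
def leg (X : El P) : (rep X.base).toPseudofunctor ⟶ Q.psd := (θ.app (op X)).hom

/-- The values of the legs of a `σ`-cone on objects. -/
def legObj (X : El P) {c : A} (g : X.base ⟶ c) : Q.psd.obj c := ((leg θ X).app c).toFunctor.obj g

/-- The values of the legs of a `σ`-cone on morphisms. -/
def legMap (X : El P) {c : A} {g g' : X.base ⟶ c} (η : g ⟶ g') : legObj θ X g ⟶ legObj θ X g' :=
  ((leg θ X).app c).toFunctor.map η

/-- The naturality isomorphisms of the legs of a `σ`-cone. -/
def legNat (X : El P) {c d : A} (g : X.base ⟶ c) (h : c ⟶ d) :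
    legObj θ X (g ≫ h) ≅ (Q.psd.map h).toFunctor.obj (legObj θ X g) :=
  natIso (leg θ X) h g

/-- The components of the structural `2`-cells of a `σ`-cone. -/
def legCell (X Y : El P) (f : X.base ⟶ Y.base) (φ : (P.map f).toFunctor.obj X.pt ⟶ Y.pt)
    {c : A} (g : Y.base ⟶ c) : legObj θ X (f ≫ g) ⟶ legObj θ Y g :=
  ((θ.cell (Quiver.Hom.op (El.arrow X Y f φ))).hom.as.app c).toNatTrans.app g

@[simp]
theorem legMap_id (X : El P) {c : A} (g : X.base ⟶ c) : legMap θ X (𝟙 g) = 𝟙 _ :=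
  ((leg θ X).app c).toFunctor.map_id g

theorem legMap_comp (X : El P) {c : A} {g g' g'' : X.base ⟶ c} (η : g ⟶ g') (κ : g' ⟶ g'') :
    legMap θ X (η ≫ κ) = legMap θ X η ≫ legMap θ X κ :=
  ((leg θ X).app c).toFunctor.map_comp η κ

instance (X : El P) {c : A} {g g' : X.base ⟶ c} (η : g ⟶ g') [IsIso η] : IsIso (legMap θ X η) :=
  ⟨legMap θ X (inv η), by rw [← legMap_comp, IsIso.hom_inv_id, legMap_id],
    by rw [← legMap_comp, IsIso.inv_hom_id, legMap_id]⟩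

theorem legNat_natural (X : El P) {c d : A} {g g' : X.base ⟶ c} (η : g ⟶ g') (h : c ⟶ d) :
    legMap θ X (η ▷ h) ≫ (legNat θ X g' h).hom =
      (legNat θ X g h).hom ≫ (Q.psd.map h).toFunctor.map (legMap θ X η) :=
  natIso_natural (leg θ X) h η

theorem legNat_map₂ (X : El P) {c d : A} (g : X.base ⟶ c) {h k : c ⟶ d} (η : h ⟶ k) :
    legMap θ X (g ◁ η) ≫ (legNat θ X g k).hom =
      (legNat θ X g h).hom ≫ (Q.psd.map₂ η).toNatTrans.app (legObj θ X g) :=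
  natIso_map₂ (leg θ X) η g

theorem legNat_id (X : El P) {c : A} (g : X.base ⟶ c) :
    (legNat θ X g (𝟙 c)).hom ≫ (Q.psd.mapId c).hom.toNatTrans.app (legObj θ X g) =
      legMap θ X (ρ_ g).hom :=
  natIso_id (leg θ X) c g

theorem legNat_comp (X : El P) {c d e : A} (g : X.base ⟶ c) (h : c ⟶ d) (k : d ⟶ e) :
    (legNat θ X g (h ≫ k)).hom ≫ (Q.psd.mapComp h k).hom.toNatTrans.app (legObj θ X g) =
      legMap θ X (α_ g h k).inv ≫ (legNat θ X (g ≫ h) k).hom ≫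
        (Q.psd.map k).toFunctor.map (legNat θ X g h).hom :=
  natIso_comp (leg θ X) h k g

section

variable (X Y : El P) (f : X.base ⟶ Y.base) (φ : (P.map f).toFunctor.obj X.pt ⟶ Y.pt)

theorem legCell_natural {c : A} {g g' : Y.base ⟶ c} (η : g ⟶ g') :
    legMap θ X (f ◁ η) ≫ legCell θ X Y f φ g' = legCell θ X Y f φ g ≫ legMap θ Y η :=
  ((θ.cell (Quiver.Hom.op (El.arrow X Y f φ))).hom.as.app c).toNatTrans.naturality η

/-- This is the modification axiom for the structural cell; the associator is the naturality of
precomposition with `f`. -/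
theorem legCell_legNat {c d : A} (g : Y.base ⟶ c) (h : c ⟶ d) :
    legCell θ X Y f φ (g ≫ h) ≫ (legNat θ Y g h).hom =
      legMap θ X (α_ f g h).inv ≫ (legNat θ X (f ≫ g) h).hom ≫
        (Q.psd.map h).toFunctor.map (legCell θ X Y f φ g) := by
  refine (modif_natural (θ.cell (Quiver.Hom.op (El.arrow X Y f φ))).hom h g).trans ?_
  change (𝟙 _ ≫ legMap θ X (α_ f g h).inv ≫ 𝟙 _ ≫ (legNat θ X (f ≫ g) h).hom ≫ 𝟙 _) ≫
        (Q.psd.map h).toFunctor.map (legCell θ X Y f φ g) = _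
  simp

/-- A 2-cell `η` of `A` into `f` lifts to `El P` once the fibre component of its source is defined
by composition with `P.map₂ η`; naturality of the cone is applied to this lift. -/
theorem legCell_map₂ {f' : X.base ⟶ Y.base} (η : f' ⟶ f) {c : A} (g : Y.base ⟶ c) :
    legMap θ X (η ▷ g) ≫ legCell θ X Y f φ g =
      legCell θ X Y f' ((P.map₂ η).toNatTrans.app X.pt ≫ φ) g :=
  congrArg (fun t => (t.hom.as.app c).toNatTrans.app g) (θ.cell_naturality (op2
    (El.cellOf X Y f φ η)))

theorem isIso_legCell [hf : IsIso φ] {c : A} (g : Y.base ⟶ c) :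
    IsIso (legCell θ X Y f φ g) := by
  have := θ.isIso_cell (Quiver.Hom.op (El.arrow X Y f φ)) hf
  let e := asIso (θ.cell (Quiver.Hom.op (El.arrow X Y f φ)))
  exact ⟨(e.inv.hom.as.app c).toNatTrans.app g,
    congrArg (fun t => (InducedBicategory.Hom₂.hom t).as.app c |>.toNatTrans.app g) e.hom_inv_id,
    congrArg (fun t => (t.hom.as.app c).toNatTrans.app g) e.inv_hom_id⟩

end

theorem legCell_id (X : El P) {c : A} (g : X.base ⟶ c) :
    legCell θ X X (𝟙 X.base) ((P.mapId X.base).hom.toNatTrans.app X.pt) g =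
      legMap θ X (λ_ g).hom := by
  refine (congrArg (fun t => (t.hom.as.app c).toNatTrans.app g) (θ.cell_id (op X))).trans ?_
  change legMap θ X (𝟙 (𝟙 X.base) ▷ g ≫ (λ_ g).hom) ≫ 𝟙 _ = _
  simp

/-- The composition axiom of the cone, with the two arrows in reversed order because the diagram is
indexed by the opposite of `El P`. -/
theorem legCell_comp (X Y Z : El P) (f : X.base ⟶ Y.base)
    (φ : (P.map f).toFunctor.obj X.pt ⟶ Y.pt) (f' : Y.base ⟶ Z.base)
    (φ' : (P.map f').toFunctor.obj Y.pt ⟶ Z.pt) {c : A} (g : Z.base ⟶ c) :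
    legCell θ X Z (f ≫ f') ((P.mapComp f f').hom.toNatTrans.app _ ≫
        (P.map f').toFunctor.map φ ≫ φ') g =
      legMap θ X (α_ f f' g).hom ≫ legCell θ X Y f φ (f' ≫ g) ≫ legCell θ Y Z f' φ' g := by
  refine (congrArg (fun t => (t.hom.as.app c).toNatTrans.app g)
    (θ.cell_comp (Quiver.Hom.op (El.arrow Y Z f' φ'))
      (Quiver.Hom.op (El.arrow X Y f φ)))).trans ?_
  change legMap θ X (𝟙 (f ≫ f') ▷ g ≫ (α_ f f' g).hom) ≫ 𝟙 _ ≫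
    legCell θ X Y f φ (f' ≫ g) ≫ legCell θ Y Z f' φ' g = _
  simp

end ConeComponents

/-! ### Coherence laws of a Cat-valued pseudofunctor at an object -/

section Strictness

variable {A : Type u} [Bicategory.{w, v} A] {P : A ⥤ᵖ Cat.{w₁, v₁}}

theorem mapId_natural {c : A} {x y : P.obj c} (u : x ⟶ y) :
    (P.map (𝟙 c)).toFunctor.map u ≫ (P.mapId c).hom.toNatTrans.app y =
      (P.mapId c).hom.toNatTrans.app x ≫ u :=
  (P.mapId c).hom.toNatTrans.naturality u

theorem mapComp_natural {c d e : A} (h : c ⟶ d) (k : d ⟶ e) {x y : P.obj c} (u : x ⟶ y) :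
    (P.map (h ≫ k)).toFunctor.map u ≫ (P.mapComp h k).hom.toNatTrans.app y =
      (P.mapComp h k).hom.toNatTrans.app x ≫
        (P.map k).toFunctor.map ((P.map h).toFunctor.map u) :=
  (P.mapComp h k).hom.toNatTrans.naturality u

theorem map₂_natural {c d : A} {h k : c ⟶ d} (η : h ⟶ k) {x y : P.obj c} (u : x ⟶ y) :
    (P.map h).toFunctor.map u ≫ (P.map₂ η).toNatTrans.app y =
      (P.map₂ η).toNatTrans.app x ≫ (P.map k).toFunctor.map u :=
  (P.map₂ η).toNatTrans.naturality u

theorem map₂_comp_app {c d : A} {h k l : c ⟶ d} (η : h ⟶ k) (κ : k ⟶ l) (x : P.obj c) :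
    (P.map₂ η).toNatTrans.app x ≫ (P.map₂ κ).toNatTrans.app x =
      (P.map₂ (η ≫ κ)).toNatTrans.app x := by
  rw [P.map₂_comp]; rfl

theorem map₂_id_app {c d : A} (h : c ⟶ d) (x : P.obj c) :
    (P.map₂ (𝟙 h)).toNatTrans.app x = 𝟙 _ := by
  rw [P.map₂_id]; rfl

theorem mapComp_id_right_app {c d : A} (h : c ⟶ d) (x : P.obj c) :
    (P.mapComp h (𝟙 d)).hom.toNatTrans.app x ≫ (P.mapId d).hom.toNatTrans.app _ =
      (P.map₂ (ρ_ h).hom).toNatTrans.app x := by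
  rw [P.map₂_right_unitor]
  change _ = _ ≫ _ ≫ 𝟙 _
  rw [Category.comp_id]
  rfl

theorem mapComp_id_left_app {c d : A} (h : c ⟶ d) (x : P.obj c) :
    (P.mapComp (𝟙 c) h).hom.toNatTrans.app x ≫
      (P.map h).toFunctor.map ((P.mapId c).hom.toNatTrans.app x) =
      (P.map₂ (λ_ h).hom).toNatTrans.app x := by
  rw [P.map₂_left_unitor]
  change _ = _ ≫ _ ≫ 𝟙 _
  rw [Category.comp_id]
  rfl

theorem mapComp_whiskerLeft_app {c d e : A} (h : c ⟶ d) {k k' : d ⟶ e} (η : k ⟶ k')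
    (x : P.obj c) :
    (P.map₂ (h ◁ η)).toNatTrans.app x ≫ (P.mapComp h k').hom.toNatTrans.app x =
      (P.mapComp h k).hom.toNatTrans.app x ≫
        (P.map₂ η).toNatTrans.app ((P.map h).toFunctor.obj x) := by
  simp

theorem mapComp_whiskerRight_app {c d e : A} {h h' : c ⟶ d} (η : h ⟶ h') (k : d ⟶ e)
    (x : P.obj c) :
    (P.map₂ (η ▷ k)).toNatTrans.app x ≫ (P.mapComp h' k).hom.toNatTrans.app x =
      (P.mapComp h k).hom.toNatTrans.app x ≫
        (P.map k).toFunctor.map ((P.map₂ η).toNatTrans.app x) := by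
  simp

theorem mapComp_assoc_app {c d e f : A} (h : c ⟶ d) (k : d ⟶ e) (l : e ⟶ f) (x : P.obj c) :
    (P.map₂ (α_ h k l).hom).toNatTrans.app x ≫ (P.mapComp h (k ≫ l)).hom.toNatTrans.app x ≫
        (P.mapComp k l).hom.toNatTrans.app ((P.map h).toFunctor.obj x) =
      (P.mapComp (h ≫ k) l).hom.toNatTrans.app x ≫
        (P.map l).toFunctor.map ((P.mapComp h k).hom.toNatTrans.app x) := by
  simp

end Strictness

/-! ### Reduction of a σ-cone to its values at identities -/

section ConeComponents

variable {A : Type u} [Bicategory.{w, v} A] [Strict A] {P : StrictPseudofunctor A Cat.{w, v}}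
  {Q : HomP A Cat.{w, v}} (θ : SigmaCone (El.cart P).op (repDiagram P) Q)

/-- The value of a `σ`-cone at a point of `P c` and the identity of `c`. -/
abbrev ptObj {c : A} (y : P.obj c) : Q.psd.obj c := legObj θ (El.mk c y) (𝟙 c)

/-- The map `θ_{(x, a)}(f) ⟶ θ_{(y, c)}(𝟙 c)` induced by an arrow `(f, φ) : (x, a) ⟶ (y, c)`. -/
def toPt (X : El P) {c : A} (f : X.base ⟶ c) {y : P.obj c}
    (φ : (P.map f).toFunctor.obj X.pt ⟶ y) : legObj θ X f ⟶ ptObj θ y :=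
  legMap θ X (ρ_ f).inv ≫ legCell θ X (El.mk c y) f φ (𝟙 c)

instance (X : El P) {c : A} (f : X.base ⟶ c) {y : P.obj c}
    (φ : (P.map f).toFunctor.obj X.pt ⟶ y) [IsIso φ] : IsIso (toPt θ X f φ) := by
  have := isIso_legCell θ X (El.mk c y) f φ (hf := ‹_›) (𝟙 c)
  unfold toPt
  infer_instance

theorem legMap_toPt (X : El P) {c : A} {f f' : X.base ⟶ c} (η : f ⟶ f') {y : P.obj c}
    (φ : (P.map f').toFunctor.obj X.pt ⟶ y) :
    legMap θ X η ≫ toPt θ X f' φ = toPt θ X f ((P.map₂ η).toNatTrans.app _ ≫ φ) := by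
  have := legCell_map₂ θ X (El.mk c y) f' φ η (𝟙 c)
  rw [toPt, toPt, ← this, ← reassoc_of% @legMap_comp, ← reassoc_of% @legMap_comp]
  simp

/-- Up to a right unitor `toPt` is itself a structural cell, so composing it with another one is an
instance of the composition axiom of the cone. -/
theorem legCell_toPt (X Y : El P) (f : X.base ⟶ Y.base)
    (φ : (P.map f).toFunctor.obj X.pt ⟶ Y.pt) {c : A} (g : Y.base ⟶ c) {z : P.obj c}
    (ψ : (P.map g).toFunctor.obj Y.pt ⟶ z) :
    legCell θ X Y f φ g ≫ toPt θ Y g ψ =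
      toPt θ X (f ≫ g) ((P.mapComp f g).hom.toNatTrans.app _ ≫
        (P.map g).toFunctor.map φ ≫ ψ) := by
  have := legCell_comp θ X Y (El.mk c z) f φ g ψ (𝟙 c)
  rw [toPt, toPt, this, ← reassoc_of% @legCell_natural, ← reassoc_of% @legMap_comp]
  simp

/-- The arrow is the identity of (y, c) in `El P`, so its cell is a left unitor; this cancels the
right unitor in `toPt` because the two unitors agree at an identity. -/
theorem toPt_mapId {c : A} (y : P.obj c) :
    toPt θ (El.mk c y) (𝟙 c) (y := y) ((P.mapId c).hom.toNatTrans.app y) = 𝟙 (ptObj θ y) := by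
  have := legCell_id θ (El.mk c y) (𝟙 c)
  refine (congrArg (legMap θ (El.mk c y) (ρ_ (𝟙 c)).inv ≫ ·) this).trans ?_
  rw [← legMap_comp, unitors_equal, Iso.inv_hom_id]
  exact legMap_id θ (El.mk c y) (𝟙 c)

/-- The action of a `σ`-cone on morphisms of `P c`. -/
def ptMap {c : A} {x y : P.obj c} (u : x ⟶ y) : ptObj θ x ⟶ ptObj θ y :=
  toPt θ (El.mk c x) (𝟙 c) ((P.mapId c).hom.toNatTrans.app x ≫ u)

theorem toPt_ptMap (X : El P) {c : A} (f : X.base ⟶ c) {y z : P.obj c}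
    (φ : (P.map f).toFunctor.obj X.pt ⟶ y) (u : y ⟶ z) :
    toPt θ X f φ ≫ ptMap θ u = toPt θ X f (φ ≫ u) := by
  have h := legCell_toPt θ X (El.mk c y) f φ (𝟙 c) ((P.mapId c).hom.toNatTrans.app y ≫ u)
  rw [ptMap, toPt, Category.assoc, h, legMap_toPt]
  -- What remains is an equation in `P c`: the right unit law of `P` together with naturality of
  -- `P.mapId`.
  congr 1
  have h₁ := mapId_natural (P := P.toPseudofunctor) φ
  have h₂ := mapComp_id_right_app (P := P.toPseudofunctor) f X.pt
  have h₃ := map₂_comp_app (P := P.toPseudofunctor) (ρ_ f).inv (ρ_ f).hom X.pt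
  rw [Iso.inv_hom_id, map₂_id_app] at h₃
  rw [reassoc_of% h₁, reassoc_of% h₂, reassoc_of% h₃]

/-- The naturality isomorphisms of the transformation determined by a `σ`-cone. -/
noncomputable def ptNat {c d : A} (h : c ⟶ d) (y : P.obj c) :
    ptObj θ ((P.map h).toFunctor.obj y) ≅ (Q.psd.map h).toFunctor.obj (ptObj θ y) :=
  -- The arrow (h, 1) : (y, c) ⟶ (P h y, d) is cartesian, so its cell can be inverted.
  (asIso (toPt θ (El.mk c y) h (𝟙 _))).symm ≪≫ asIso (legMap θ (El.mk c y) (λ_ h).inv) ≪≫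
    legNat θ (El.mk c y) (𝟙 c) h

theorem toPt_ptNat {c d : A} (h : c ⟶ d) (y : P.obj c) :
    toPt θ (El.mk c y) h (𝟙 _) ≫ (ptNat θ h y).hom =
      legMap θ (El.mk c y) (λ_ h).inv ≫ (legNat θ (El.mk c y) (𝟙 c) h).hom := by
  rw [ptNat, Iso.trans_hom, Iso.symm_hom, asIso_inv, IsIso.hom_inv_id_assoc]
  rfl

/-- The comparison maps intertwine the naturality of the legs with `ptNat`. Most of the axioms for
`ofCone` and the modification axiom in `isoOfCone` reduce to this or to its special case
`toPt_ptNat`. -/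
theorem legNat_toPt (X : El P) {c d : A} (f : X.base ⟶ c) (h : c ⟶ d) {y : P.obj c}
    (φ : (P.map f).toFunctor.obj X.pt ⟶ y) :
    (legNat θ X f h).hom ≫ (Q.psd.map h).toFunctor.map (toPt θ X f φ) =
      toPt θ X (f ≫ h) ((P.mapComp f h).hom.toNatTrans.app _ ≫ (P.map h).toFunctor.map φ) ≫
        (ptNat θ h y).hom := by
  have h₁ := legCell_toPt θ X (El.mk c y) f φ h (𝟙 _)
  have h₂ := legCell_legNat θ X (El.mk c y) f φ (𝟙 c) h
  have h₃ := legCell_natural θ X (El.mk c y) f φ (λ_ h).inv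
  rw [Category.comp_id] at h₁
  rw [← h₁, Category.assoc, toPt_ptNat, ← reassoc_of% h₃, h₂, ← reassoc_of% @legMap_comp, toPt,
    CategoryTheory.Functor.map_comp, ← reassoc_of% @legNat_natural]
  simp

end ConeComponents

/-! ### Composite transformations and invertible modifications -/

section Components

variable {A : Type u} [Bicategory.{w, v} A] {P Q R : A ⥤ᵖ Cat.{w₁, v₁}}

theorem natIso_comp_hom (s : P ⟶ Q) (t : Q ⟶ R) {c d : A} (h : c ⟶ d) (x : P.obj c) :
    (natIso (s ≫ t) h x).hom = (t.app d).toFunctor.map (natIso s h x).hom ≫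
      (natIso t h ((s.app c).toFunctor.obj x)).hom := by
  change 𝟙 _ ≫ (t.app d).toFunctor.map (natIso s h x).hom ≫ 𝟙 _ ≫ (natIso t h _).hom ≫ 𝟙 _ = _
  rw [Category.id_comp, Category.id_comp, Category.comp_id]

theorem isIso_modif {s t : P ⟶ Q} (m : s ⟶ t)
    [∀ c x, IsIso ((m.as.app c).toNatTrans.app x)] : IsIso m :=
  ⟨(mkModifIso (s := s) (t := t) (fun c x => asIso ((m.as.app c).toNatTrans.app x))
      (fun c _ _ u => (m.as.app c).toNatTrans.naturality u) (modif_natural m)).inv,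
    modif_ext fun c x => IsIso.hom_inv_id ((m.as.app c).toNatTrans.app x),
    modif_ext fun c x => IsIso.inv_hom_id ((m.as.app c).toNatTrans.app x)⟩

theorem isIso_homP {F G : HomP A Cat.{w₁, v₁}} {s t : F ⟶ G} (m : s ⟶ t) [IsIso m.hom] :
    IsIso m :=
  ⟨InducedBicategory.Hom₂.mk (inv m.hom),
    InducedBicategory.hom₂_ext (IsIso.hom_inv_id m.hom),
    InducedBicategory.hom₂_ext (IsIso.inv_hom_id m.hom)⟩

theorem mapComp_assoc_inv_app {c d e f : A} (h : c ⟶ d) (k : d ⟶ e) (l : e ⟶ f) (x : P.obj c) :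
    (P.map₂ (α_ h k l).inv).toNatTrans.app x ≫ (P.mapComp (h ≫ k) l).hom.toNatTrans.app x ≫
        (P.map l).toFunctor.map ((P.mapComp h k).hom.toNatTrans.app x) =
      (P.mapComp h (k ≫ l)).hom.toNatTrans.app x ≫
        (P.mapComp k l).hom.toNatTrans.app ((P.map h).toFunctor.obj x) := by
  rw [← mapComp_assoc_app, ← Category.assoc, map₂_comp_app, Iso.inv_hom_id, map₂_id_app,
    Category.id_comp]

end Components

/-! ### The Yoneda cone with vertex P and the factorization of σ-cones -/

section ConeComponents

variable {A : Type u} [Bicategory.{w, v} A] [Strict A] {P : StrictPseudofunctor A Cat.{w, v}}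
  {Q : HomP A Cat.{w, v}} (θ : SigmaCone (El.cart P).op (repDiagram P) Q)

theorem toPt_id_ptMap (X : El P) {c : A} (f : X.base ⟶ c) {z : P.obj c}
    (u : (P.map f).toFunctor.obj X.pt ⟶ z) :
    toPt θ X f (𝟙 _) ≫ ptMap θ u = toPt θ X f u :=
  (toPt_ptMap θ X f (𝟙 _) u).trans (congrArg (toPt θ X f) (Category.id_comp u))

/-- The pseudonatural transformation determined by a `σ`-cone. -/
noncomputable def ofCone : P.toPseudofunctor ⟶ Q.psd :=
  mkTrans (fun _ y => ptObj θ y) (fun _ _ _ u => ptMap θ u) (fun h y => ptNat θ h y)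
    (fun c x => by exact (congrArg (toPt θ _ _) (Category.comp_id _)).trans (toPt_mapId θ x))
    (fun c x y z u v => by
      rw [ptMap, ptMap, toPt_ptMap, Category.assoc])
    (fun {c d} h x y u => by
      -- The comparison map of the cartesian arrow (h, 1) is invertible, so the equation can be
      -- tested after it, where `ptNat` becomes the naturality of a leg. The later axioms use the
      -- same device.
      rw [← cancel_epi (toPt θ (El.mk c x) h (𝟙 _)), reassoc_of% @toPt_ptMap,
        reassoc_of% @toPt_ptNat, ptMap, legNat_toPt, reassoc_of% @legMap_toPt,
        CategoryTheory.Functor.map_comp]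
      have h₁ := mapComp_id_left_app (P := P.toPseudofunctor) h x
      have h₂ := map₂_comp_app (P := P.toPseudofunctor) (λ_ h).inv (λ_ h).hom x
      rw [Iso.inv_hom_id, map₂_id_app] at h₂
      rw [reassoc_of% h₁, reassoc_of% h₂, Category.id_comp])
    (fun {c d h k} η x => by
      have := legMap_toPt θ (El.mk c x) η (𝟙 _)
      rw [Category.comp_id] at this
      rw [← cancel_epi (toPt θ (El.mk c x) h (𝟙 _)), reassoc_of% @toPt_ptMap,
        reassoc_of% @toPt_ptNat, ← legNat_map₂, Category.id_comp, ← this, Category.assoc,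
        toPt_ptNat, ← reassoc_of% @legMap_comp, ← reassoc_of% @legMap_comp]
      simp)
    (fun c x => by
      rw [← cancel_epi (toPt θ (El.mk c x) (𝟙 c) (𝟙 _)), reassoc_of% @toPt_ptNat, toPt_ptMap,
        legNat_id, ← legMap_comp, ← unitors_equal, Iso.inv_hom_id]
      exact (legMap_id θ _ _).trans
        ((congrArg (toPt θ _ _) (Category.id_comp _)).trans (toPt_mapId θ x)).symm)
    (fun {c d e} h k x => by
      have h₁ : (legNat θ (El.mk c x) h k).hom ≫
          (Q.psd.map k).toFunctor.map (toPt θ (El.mk c x) h (𝟙 ((P.map h).toFunctor.obj x))) =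
          toPt θ (El.mk c x) (h ≫ k) ((P.mapComp h k).hom.toNatTrans.app x) ≫
            (ptNat θ k ((P.map h).toFunctor.obj x)).hom := by
        rw [legNat_toPt, CategoryTheory.Functor.map_id]
        congr 1
        exact congrArg (toPt θ (El.mk c x) (h ≫ k)) (Category.comp_id _)
      rw [← cancel_epi (toPt θ (El.mk c x) (h ≫ k) (𝟙 _)), reassoc_of% @toPt_ptNat,
        reassoc_of% @toPt_id_ptMap, legNat_comp, ← reassoc_of% h₁,
        ← CategoryTheory.Functor.map_comp, toPt_ptNat, CategoryTheory.Functor.map_comp,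
        ← reassoc_of% @legNat_natural,
        ← reassoc_of% @legMap_comp]
      simp)

/-- The comparison isomorphism `θ_{(x, a)}(f) ≅ θ_{(P f x, c)}(𝟙 c)`. -/
noncomputable def toPtIso (X : El P) {c : A} (f : X.base ⟶ c) :
    legObj θ X f ≅ ptObj θ ((P.map f).toFunctor.obj X.pt) :=
  asIso (toPt θ X f (𝟙 _))

/-- The transformation `A(a, -) ⟶ P` corresponding to a point of `P a`. -/
def pointLeg (X : El P) : (rep X.base).toPseudofunctor ⟶ P.toPseudofunctor :=
  mkTrans (P := (rep X.base).toPseudofunctor)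
    (fun c (g : X.base ⟶ c) => (P.map g).toFunctor.obj X.pt)
    (fun c (g g' : X.base ⟶ c) (η : g ⟶ g') => (P.map₂ η).toNatTrans.app X.pt)
    (fun h (g : X.base ⟶ _) => (Cat.Hom.toNatIso (P.mapComp g h)).app X.pt)
    (fun c (g : X.base ⟶ c) => map₂_id_app (P := P.toPseudofunctor) g X.pt)
    (fun _ _ _ _ η κ => (map₂_comp_app (P := P.toPseudofunctor) η κ X.pt).symm)
    (fun h _ _ η => mapComp_whiskerRight_app (P := P.toPseudofunctor) η h X.pt)
    (fun η g => mapComp_whiskerLeft_app (P := P.toPseudofunctor) g η X.pt)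
    (fun _ g => mapComp_id_right_app (P := P.toPseudofunctor) g X.pt)
    (fun h k g =>
      (mapComp_assoc_inv_app (P := P.toPseudofunctor) g h k X.pt).symm)

variable (P) in
/-- The `σ`-cone with vertex `P` given by the Yoneda lemma. -/
def pointCone : SigmaCone (El.cart P).op (repDiagram P) (HomP.of P) where
  app i := InducedBicategory.mkHom (pointLeg i.unop)
  cell {i j} f := InducedBicategory.Hom₂.mk (mkModif (s := repMap f.unop.base ≫ pointLeg j.unop)
    (t := pointLeg i.unop)
    -- This is the fibre component of the composite of (f, φ) with the cartesian arrow (g, 1).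
    (fun c (g : i.unop.base ⟶ c) => (P.mapComp f.unop.base g).hom.toNatTrans.app j.unop.pt ≫
      (P.map g).toFunctor.map f.unop.fib)
    (fun c (g g' : i.unop.base ⟶ c) (η : g ⟶ g') => by
      change (P.map₂ (f.unop.base ◁ η)).toNatTrans.app j.unop.pt ≫
        (P.mapComp f.unop.base g').hom.toNatTrans.app j.unop.pt ≫
          (P.map g').toFunctor.map f.unop.fib =
        ((P.mapComp f.unop.base g).hom.toNatTrans.app j.unop.pt ≫
          (P.map g).toFunctor.map f.unop.fib) ≫ (P.map₂ η).toNatTrans.app i.unop.pt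
      have h₁ := mapComp_whiskerLeft_app (P := P.toPseudofunctor) f.unop.base η j.unop.pt
      have h₂ := map₂_natural (P := P.toPseudofunctor) η f.unop.fib
      rw [reassoc_of% h₁, Category.assoc, h₂])
    (fun {c d} h (g : i.unop.base ⟶ c) => by
      refine Eq.trans ?_ (congrArg (· ≫ _)
        (natIso_comp_hom (repMap f.unop.base) (pointLeg j.unop) h g).symm)
      change ((P.mapComp f.unop.base (g ≫ h)).hom.toNatTrans.app j.unop.pt ≫
        (P.map (g ≫ h)).toFunctor.map f.unop.fib) ≫
          (P.mapComp g h).hom.toNatTrans.app i.unop.pt =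
        ((P.map₂ (α_ f.unop.base g h).inv).toNatTrans.app j.unop.pt ≫
          (P.mapComp (f.unop.base ≫ g) h).hom.toNatTrans.app j.unop.pt) ≫
          (P.map h).toFunctor.map ((P.mapComp f.unop.base g).hom.toNatTrans.app j.unop.pt ≫
            (P.map g).toFunctor.map f.unop.fib)
      have h₁ := mapComp_assoc_inv_app (P := P.toPseudofunctor) f.unop.base g h j.unop.pt
      have h₂ := mapComp_natural (P := P.toPseudofunctor) g h f.unop.fib
      rw [CategoryTheory.Functor.map_comp, Category.assoc, Category.assoc, h₂,
        reassoc_of% h₁]))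
  cell_naturality {i j f f'} η := homP_ext₂ fun c (g : i.unop.base ⟶ c) => by
    change (P.map₂ (η.unop2.cell ▷ g)).toNatTrans.app j.unop.pt ≫
      (P.mapComp f'.unop.base g).hom.toNatTrans.app j.unop.pt ≫
        (P.map g).toFunctor.map f'.unop.fib =
      (P.mapComp f.unop.base g).hom.toNatTrans.app j.unop.pt ≫
        (P.map g).toFunctor.map f.unop.fib
    have h₁ := mapComp_whiskerRight_app (P := P.toPseudofunctor) η.unop2.cell g j.unop.pt
    rw [reassoc_of% h₁, ← CategoryTheory.Functor.map_comp, El.Hom₂.w]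
  cell_id i := homP_ext₂ fun c (g : i.unop.base ⟶ c) => by
    change (P.mapComp (𝟙 i.unop.base) g).hom.toNatTrans.app i.unop.pt ≫
      (P.map g).toFunctor.map ((P.mapId i.unop.base).hom.toNatTrans.app i.unop.pt) =
      (P.map₂ (𝟙 (𝟙 i.unop.base) ▷ g ≫ (λ_ g).hom)).toNatTrans.app i.unop.pt ≫ 𝟙 _
    have h₁ := mapComp_id_left_app (P := P.toPseudofunctor) g i.unop.pt
    have h₂ : 𝟙 (𝟙 i.unop.base) ▷ g ≫ (λ_ g).hom = (λ_ g).hom := by simp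
    rw [h₁, h₂, Category.comp_id]
  cell_comp {i j k} f f' := homP_ext₂ fun c (g : i.unop.base ⟶ c) => by
    change (P.mapComp (f'.unop.base ≫ f.unop.base) g).hom.toNatTrans.app k.unop.pt ≫
      (P.map g).toFunctor.map
        ((P.mapComp f'.unop.base f.unop.base).hom.toNatTrans.app k.unop.pt ≫
          (P.map f.unop.base).toFunctor.map f'.unop.fib ≫ f.unop.fib) =
      (P.map₂ (𝟙 (f'.unop.base ≫ f.unop.base) ▷ g ≫
        (α_ f'.unop.base f.unop.base g).hom)).toNatTrans.app k.unop.pt ≫ 𝟙 _ ≫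
        ((P.mapComp f'.unop.base (f.unop.base ≫ g)).hom.toNatTrans.app k.unop.pt ≫
          (P.map (f.unop.base ≫ g)).toFunctor.map f'.unop.fib) ≫
        ((P.mapComp f.unop.base g).hom.toNatTrans.app j.unop.pt ≫
          (P.map g).toFunctor.map f.unop.fib)
    have h₁ := mapComp_assoc_app (P := P.toPseudofunctor) f'.unop.base f.unop.base g
      k.unop.pt
    have h₂ := mapComp_natural (P := P.toPseudofunctor) f.unop.base g f'.unop.fib
    have h₃ : 𝟙 (f'.unop.base ≫ f.unop.base) ▷ g ≫ (α_ f'.unop.base f.unop.base g).hom =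
      (α_ f'.unop.base f.unop.base g).hom := by simp
    rw [h₃, Category.id_comp, CategoryTheory.Functor.map_comp, CategoryTheory.Functor.map_comp,
      ← reassoc_of% h₁, ← reassoc_of% h₂]
    exact congrArg (_ ≫ ·) (Category.assoc _ _ _).symm
  isIso_cell {i j} f hf := by
    have : IsIso f.unop.fib := hf
    refine @isIso_homP _ _ _ _ _ _ _ (@isIso_modif _ _ _ _ _ _ _ fun c (g : i.unop.base ⟶ c) => ?_)
    change IsIso ((P.mapComp f.unop.base g).hom.toNatTrans.app j.unop.pt ≫
      (P.map g).toFunctor.map f.unop.fib)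
    infer_instance

/-- A `σ`-cone factors through the transformation that it determines. -/
noncomputable def isoOfCone : θ ≅ ((pointCone P).precomp Q).obj
    (InducedBicategory.mkHom (X := HomP.of P) (Y := Q) (ofCone θ)) :=
  SigmaCone.isoMk (fun i => InducedBicategory.isoMk (mkModifIso (s := leg θ i.unop)
    (t := pointLeg i.unop ≫ ofCone θ)
    (fun c (g : i.unop.base ⟶ c) => toPtIso θ i.unop g)
    (fun c (g g' : i.unop.base ⟶ c) (η : g ⟶ g') => by
      change legMap θ i.unop η ≫ toPt θ i.unop g' (𝟙 _) =
        toPt θ i.unop g (𝟙 _) ≫ ptMap θ ((P.map₂ η).toNatTrans.app i.unop.pt)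
      rw [legMap_toPt, toPt_ptMap, Category.id_comp, Category.comp_id])
    (fun {c d} h (g : i.unop.base ⟶ c) => by
      refine (congrArg (_ ≫ ·) (natIso_comp_hom (pointLeg i.unop) (ofCone θ) h g)).trans ?_
      change toPt θ i.unop (g ≫ h) (𝟙 _) ≫
        ptMap θ ((P.mapComp g h).hom.toNatTrans.app i.unop.pt) ≫ (ptNat θ h _).hom =
        (legNat θ i.unop g h).hom ≫ (Q.psd.map h).toFunctor.map (toPt θ i.unop g (𝟙 _))
      rw [legNat_toPt, reassoc_of% @toPt_ptMap, CategoryTheory.Functor.map_id, Category.id_comp]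
      exact congrArg (toPt θ i.unop (g ≫ h) · ≫ (ptNat θ h _).hom) (Category.comp_id _).symm)))
    (fun {i j} f => homP_ext₂ fun c (g : i.unop.base ⟶ c) => by
      change toPt θ j.unop (f.unop.base ≫ g) (𝟙 _) ≫ 𝟙 _ ≫
        ptMap θ ((P.mapComp f.unop.base g).hom.toNatTrans.app j.unop.pt ≫
          (P.map g).toFunctor.map f.unop.fib) =
        legCell θ j.unop i.unop f.unop.base f.unop.fib g ≫ toPt θ i.unop g (𝟙 _)
      rw [legCell_toPt, Category.comp_id, Category.id_comp, toPt_ptMap, Category.id_comp])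

end ConeComponents

/-! ### Full faithfulness of precomposition with the Yoneda cone -/

section ConeMorphisms

variable {A : Type u} [Bicategory.{w, v} A] [Strict A] {P : StrictPseudofunctor A Cat.{w, v}}
  {Q : HomP A Cat.{w, v}} {s t : HomP.of P ⟶ Q}

/-- The pseudonatural transformation underlying an arrow of `HomP`. -/
abbrev trans (s : HomP.of P ⟶ Q) : P.toPseudofunctor ⟶ Q.psd := s.hom

section

variable (r : ((pointCone P).precomp Q).obj s ⟶ ((pointCone P).precomp Q).obj t)

/-- The components of a morphism of `σ`-cones between composites with `pointCone`. -/
def coneHomApp (X : El P) {c : A} (g : X.base ⟶ c) :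
    ((trans s).app c).toFunctor.obj ((P.map g).toFunctor.obj X.pt) ⟶
      ((trans t).app c).toFunctor.obj ((P.map g).toFunctor.obj X.pt) :=
  ((r.app (op X)).hom.as.app c).toNatTrans.app g

theorem coneHomApp_natural (X : El P) {c : A} {g g' : X.base ⟶ c} (η : g ⟶ g') :
    ((trans s).app c).toFunctor.map ((P.map₂ η).toNatTrans.app X.pt) ≫ coneHomApp r X g' =
      coneHomApp r X g ≫ ((trans t).app c).toFunctor.map ((P.map₂ η).toNatTrans.app X.pt) :=
  ((r.app (op X)).hom.as.app c).toNatTrans.naturality η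

theorem coneHomApp_natIso (X : El P) {c d : A} (g : X.base ⟶ c) (h : c ⟶ d) :
    coneHomApp r X (g ≫ h) ≫
        ((trans t).app d).toFunctor.map ((P.mapComp g h).hom.toNatTrans.app X.pt) ≫
          (natIso (trans t) h ((P.map g).toFunctor.obj X.pt)).hom =
      ((trans s).app d).toFunctor.map ((P.mapComp g h).hom.toNatTrans.app X.pt) ≫
        (natIso (trans s) h ((P.map g).toFunctor.obj X.pt)).hom ≫
          (Q.psd.map h).toFunctor.map (coneHomApp r X g) := by
  have := modif_natural (r.app (op X)).hom h g
  refine (congrArg (coneHomApp r X (g ≫ h) ≫ ·)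
    (natIso_comp_hom (pointLeg X) (trans t) h g).symm).trans (this.trans ?_)
  refine (congrArg (· ≫ (Q.psd.map h).toFunctor.map (coneHomApp r X g))
    (natIso_comp_hom (pointLeg X) (trans s) h g)).trans ?_
  exact Category.assoc _ _ _

theorem coneHomApp_cell (X Y : El P) (f : X.base ⟶ Y.base)
    (φ : (P.map f).toFunctor.obj X.pt ⟶ Y.pt) {c : A} (g : Y.base ⟶ c) :
    coneHomApp r X (f ≫ g) ≫ ((trans t).app c).toFunctor.map
        ((P.mapComp f g).hom.toNatTrans.app X.pt ≫ (P.map g).toFunctor.map φ) =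
      ((trans s).app c).toFunctor.map
        ((P.mapComp f g).hom.toNatTrans.app X.pt ≫ (P.map g).toFunctor.map φ) ≫
        coneHomApp r Y g := by
  have := congrArg (fun t => (InducedBicategory.Hom₂.hom t).as.app c |>.toNatTrans.app g)
    (r.w (Quiver.Hom.op (El.arrow X Y f φ)))
  change coneHomApp r X (f ≫ g) ≫ 𝟙 _ ≫ ((trans t).app c).toFunctor.map
      ((P.mapComp f g).hom.toNatTrans.app X.pt ≫ (P.map g).toFunctor.map φ) =
    (𝟙 _ ≫ ((trans s).app c).toFunctor.map
      ((P.mapComp f g).hom.toNatTrans.app X.pt ≫ (P.map g).toFunctor.map φ)) ≫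
      coneHomApp r Y g at this
  rwa [Category.id_comp, Category.id_comp] at this

/-- The components of the modification determined by a morphism of `σ`-cones. -/
def ptHom {c : A} (y : P.obj c) : ((trans s).app c).toFunctor.obj y ⟶
    ((trans t).app c).toFunctor.obj y :=
  ((trans s).app c).toFunctor.map ((P.mapId c).inv.toNatTrans.app y) ≫
    coneHomApp r (El.mk c y) (𝟙 c) ≫
      ((trans t).app c).toFunctor.map ((P.mapId c).hom.toNatTrans.app y)

theorem map_mapId_ptHom {c : A} (y : P.obj c) :
    ((trans s).app c).toFunctor.map ((P.mapId c).hom.toNatTrans.app y) ≫ ptHom r y =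
      coneHomApp r (El.mk c y) (𝟙 c) ≫
        ((trans t).app c).toFunctor.map ((P.mapId c).hom.toNatTrans.app y) := by
  rw [ptHom, ← CategoryTheory.Functor.map_comp_assoc, Cat.Hom.hom_inv_id_toNatTrans_app,
    CategoryTheory.Functor.map_id, Category.id_comp]

/-- Compatibility of `r` with the cell of (f, φ) : X ⟶ (y, c), evaluated at `𝟙 c`, relates its
component at `f ≫ 𝟙 c` to the one defining `ptHom`; naturality along the right unitor replaces `f ≫
𝟙 c` by `f`. Thus `ptHom` controls all components of `r`. -/
theorem coneHomApp_comp_map (X : El P) {c : A} (f : X.base ⟶ c) {y : P.obj c}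
    (φ : (P.map f).toFunctor.obj X.pt ⟶ y) :
    coneHomApp r X f ≫ ((trans t).app c).toFunctor.map φ =
      ((trans s).app c).toFunctor.map φ ≫ ptHom r y := by
  have h₁ := coneHomApp_natural r X (ρ_ f).hom
  have h₂ := coneHomApp_cell r X (El.mk c y) f φ (𝟙 c)
  have h₃ : (P.mapComp f (𝟙 c)).hom.toNatTrans.app X.pt ≫ (P.map (𝟙 c)).toFunctor.map φ ≫
      (P.mapId c).hom.toNatTrans.app y = (P.map₂ (ρ_ f).hom).toNatTrans.app X.pt ≫ φ := by
    have h₄ := mapId_natural (P := P.toPseudofunctor) φ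
    have h₅ := mapComp_id_right_app (P := P.toPseudofunctor) f X.pt
    rw [h₄, reassoc_of% h₅]
  have h₆ := h₂ =≫ ((trans t).app c).toFunctor.map ((P.mapId c).hom.toNatTrans.app y)
  rw [Category.assoc, Category.assoc, ← map_mapId_ptHom, ← CategoryTheory.Functor.map_comp,
    ← CategoryTheory.Functor.map_comp_assoc, Category.assoc, h₃,
    CategoryTheory.Functor.map_comp, CategoryTheory.Functor.map_comp, Category.assoc,
    ← reassoc_of% h₁] at h₆
  have : IsIso ((P.map₂ (ρ_ f).hom).toNatTrans.app X.pt) :=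
    inferInstanceAs (IsIso ((Cat.Hom.toNatIso (P.map₂Iso (ρ_ f))).app X.pt).hom)
  exact (cancel_epi (((trans s).app c).toFunctor.map _)).1 h₆

/-- The modification determined by a morphism of `σ`-cones. -/
def ofConeHom : s ⟶ t := InducedBicategory.Hom₂.mk <|
  mkModif (s := trans s) (t := trans t) (fun _ y => ptHom r y)
    (fun c {x y} u => by
      rw [← cancel_epi (((trans s).app c).toFunctor.map ((P.mapId c).hom.toNatTrans.app x)),
        reassoc_of% @map_mapId_ptHom, ← CategoryTheory.Functor.map_comp,
        ← CategoryTheory.Functor.map_comp_assoc, coneHomApp_comp_map])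
    (fun {c d} h x => by
      -- The modification axiom of `r` is taken at the point x and the identity of c, then
      -- transported along P 1 x = x.
      have h₁ := coneHomApp_natIso r (El.mk c x) (𝟙 c) h =≫
        (Q.psd.map h).toFunctor.map (((trans t).app c).toFunctor.map
          ((P.mapId c).hom.toNatTrans.app x))
      rw [Category.assoc, Category.assoc, Category.assoc, Category.assoc,
        ← CategoryTheory.Functor.map_comp, ← map_mapId_ptHom, CategoryTheory.Functor.map_comp,
        ← natIso_natural, ← reassoc_of% @natIso_natural, ← CategoryTheory.Functor.map_comp_assoc,
        ← CategoryTheory.Functor.map_comp_assoc, reassoc_of% @coneHomApp_comp_map] at h₁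
      -- The cancelled map is the image of the invertible morphism P (𝟙 c ≫ h) x ⟶ P h x.
      exact (cancel_epi (((trans s).app d).toFunctor.map _)).1 h₁)

theorem map_ofConeHom : ((pointCone P).precomp Q).map (ofConeHom r) = r :=
  SigmaCone.hom_ext fun i => homP_ext₂ fun c (g : i.unop.base ⟶ c) => by
    have := coneHomApp_comp_map r i.unop g (𝟙 _)
    change ptHom r ((P.map g).toFunctor.obj i.unop.pt) = coneHomApp r i.unop g
    rw [CategoryTheory.Functor.map_id, CategoryTheory.Functor.map_id, Category.id_comp] at this
    exact this.symm.trans (Category.comp_id _)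

end

/-- The leg at (y, c) sends `𝟙 c` to P 1 y, so equal images agree there; naturality along the
invertible `P.mapId` carries this to y. -/
theorem precomp_pointCone_injective {m m' : s ⟶ t}
    (h : ((pointCone P).precomp Q).map m = ((pointCone P).precomp Q).map m') : m = m' :=
  homP_ext₂ fun c (y : P.obj c) => by
    have h₁ : (m.hom.as.app c).toNatTrans.app ((P.map (𝟙 c)).toFunctor.obj y) =
        (m'.hom.as.app c).toNatTrans.app ((P.map (𝟙 c)).toFunctor.obj y) :=
      congrArg (fun r => ((r.app (op (El.mk c y))).hom.as.app c).toNatTrans.app (𝟙 c)) h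
    have h₂ := (m.hom.as.app c).toNatTrans.naturality ((P.mapId c).hom.toNatTrans.app y)
    have h₃ := (m'.hom.as.app c).toNatTrans.naturality ((P.mapId c).hom.toNatTrans.app y)
    rw [h₁, ← h₃] at h₂
    exact (cancel_epi (((trans s).app c).toFunctor.map _)).1 h₂

theorem isSigmaBicolimit_pointCone (P : StrictPseudofunctor A Cat.{w, v}) :
    IsSigmaBicolimit (pointCone P) := fun _ =>
  { faithful := ⟨fun h => precomp_pointCone_injective h⟩
    full := ⟨fun r => ⟨ofConeHom r, map_ofConeHom r⟩⟩
    essSurj := ⟨fun θ => ⟨_, ⟨(isoOfCone θ).symm⟩⟩⟩ }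

end ConeMorphisms

/-! ### Replacing a pseudofunctor by full subcategories on indexed objects -/

section Induced

variable {A : Type u} [Bicategory.{w, v} A]

/-- Families of objects of a `Cat`-valued pseudofunctor, on which the pseudofunctor acts up to
isomorphism. -/
structure ObjFamily (P : A ⥤ᵖ Cat.{w₁, v₁}) where
  /-- The indices. -/
  idx (c : A) : Type v₁
  /-- The objects. -/
  pt (c : A) : idx c → P.obj c
  /-- The action on indices. -/
  push {c d : A} (h : c ⟶ d) : idx c → idx d
  /-- Compatibility of the actions. -/
  iso {c d : A} (h : c ⟶ d) (z : idx c) : pt d (push h z) ≅ (P.map h).toFunctor.obj (pt c z)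

namespace ObjFamily

variable {P : A ⥤ᵖ Cat.{w₁, v₁}} (O : ObjFamily P)

/-- The full subcategory on a family of objects. -/
abbrev Full (c : A) : Type v₁ := InducedCategory (P.obj c) (O.pt c)

/-- The action of `P` on the full subcategories. -/
def map {c d : A} (h : c ⟶ d) : O.Full c ⥤ O.Full d where
  obj z := (O.push h z : O.idx d)
  map {z z'} f := InducedCategory.homMk
    ((O.iso h z).hom ≫ (P.map h).toFunctor.map f.hom ≫ (O.iso h z').inv)
  map_id z := InducedCategory.hom_ext (by simp)
  map_comp f g := InducedCategory.hom_ext (by simp)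

/-- The action on `2`-cells. -/
def map₂ {c d : A} {h k : c ⟶ d} (η : h ⟶ k) : O.map h ⟶ O.map k where
  app z := InducedCategory.homMk
    ((O.iso h z).hom ≫ (P.map₂ η).toNatTrans.app _ ≫ (O.iso k z).inv)
  naturality z z' f := InducedCategory.hom_ext (by
    change ((O.iso h z).hom ≫ (P.map h).toFunctor.map f.hom ≫ (O.iso h z').inv) ≫
        ((O.iso h z').hom ≫ (P.map₂ η).toNatTrans.app _ ≫ (O.iso k z').inv) =
      ((O.iso h z).hom ≫ (P.map₂ η).toNatTrans.app _ ≫ (O.iso k z).inv) ≫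
        ((O.iso k z).hom ≫ (P.map k).toFunctor.map f.hom ≫ (O.iso k z').inv)
    simp)

/-- The unit isomorphisms. -/
def mapId (c : A) : O.map (𝟙 c) ≅ 𝟭 (O.Full c) :=
  NatIso.ofComponents (fun z => InducedCategory.isoMk
      (O.iso (𝟙 c) z ≪≫ (Cat.Hom.toNatIso (P.mapId c)).app (O.pt c z)))
    (fun {z z'} f => InducedCategory.hom_ext (by
      change ((O.iso (𝟙 c) z).hom ≫ (P.map (𝟙 c)).toFunctor.map f.hom ≫ (O.iso (𝟙 c) z').inv) ≫
          ((O.iso (𝟙 c) z').hom ≫ (P.mapId c).hom.toNatTrans.app (O.pt c z')) =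
        ((O.iso (𝟙 c) z).hom ≫ (P.mapId c).hom.toNatTrans.app (O.pt c z)) ≫ f.hom
      have := mapId_natural (P := P) f.hom
      simp [this]))

/-- The composition isomorphisms. -/
def mapComp {c d e : A} (h : c ⟶ d) (k : d ⟶ e) : O.map (h ≫ k) ≅ O.map h ⋙ O.map k :=
  NatIso.ofComponents (fun z => InducedCategory.isoMk
      (O.iso (h ≫ k) z ≪≫ (Cat.Hom.toNatIso (P.mapComp h k)).app (O.pt c z) ≪≫
        (P.map k).toFunctor.mapIso (O.iso h z).symm ≪≫ (O.iso k (O.push h z)).symm))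
    (fun {z z'} f => InducedCategory.hom_ext (by
      change ((O.iso (h ≫ k) z).hom ≫ (P.map (h ≫ k)).toFunctor.map f.hom ≫
          (O.iso (h ≫ k) z').inv) ≫ ((O.iso (h ≫ k) z').hom ≫
            (P.mapComp h k).hom.toNatTrans.app _ ≫
            (P.map k).toFunctor.map (O.iso h z').inv ≫ (O.iso k (O.push h z')).inv) =
        ((O.iso (h ≫ k) z).hom ≫ (P.mapComp h k).hom.toNatTrans.app _ ≫
          (P.map k).toFunctor.map (O.iso h z).inv ≫ (O.iso k (O.push h z)).inv) ≫
        ((O.iso k (O.push h z)).hom ≫ (P.map k).toFunctor.map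
          ((O.iso h z).hom ≫ (P.map h).toFunctor.map f.hom ≫ (O.iso h z').inv) ≫
            (O.iso k (O.push h z')).inv)
      have := mapComp_natural (P := P) h k f.hom
      simp [reassoc_of% this]))

/-- The pseudofunctor of full subcategories on a family of objects. -/
def psd : A ⥤ᵖ Cat.{w₁, v₁} where
  obj c := Cat.of (O.Full c)
  map h := (O.map h).toCatHom
  map₂ η := (O.map₂ η).toCatHom₂
  -- All structure is that of `P` conjugated by the isomorphisms `O.iso`; in each law these cancel
  -- and leave the corresponding law of `P`.
  map₂_id h := cat_ext₂ fun (z : O.Full _) => InducedCategory.hom_ext (by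
    change (O.iso h z).hom ≫ (P.map₂ (𝟙 h)).toNatTrans.app _ ≫ (O.iso h z).inv = 𝟙 _
    rw [map₂_id_app, Category.id_comp, Iso.hom_inv_id])
  map₂_comp {c d h k l} η κ := cat_ext₂ fun (z : O.Full _) => InducedCategory.hom_ext (by
    change (O.iso h z).hom ≫ (P.map₂ (η ≫ κ)).toNatTrans.app _ ≫ (O.iso l z).inv =
      ((O.iso h z).hom ≫ (P.map₂ η).toNatTrans.app _ ≫ (O.iso k z).inv) ≫
      ((O.iso k z).hom ≫ (P.map₂ κ).toNatTrans.app _ ≫ (O.iso l z).inv)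
    simp)
  mapId c := Cat.Hom.isoMk (O.mapId c)
  mapComp h k := Cat.Hom.isoMk (O.mapComp h k)
  map₂_whisker_left {c d e} h {k l} η := cat_ext₂ fun (z : O.Full _) =>
      InducedCategory.hom_ext (by
    change (O.iso (h ≫ k) z).hom ≫ (P.map₂ (h ◁ η)).toNatTrans.app _ ≫ (O.iso (h ≫ l) z).inv =
      ((O.iso (h ≫ k) z).hom ≫ (P.mapComp h k).hom.toNatTrans.app _ ≫
        (P.map k).toFunctor.map (O.iso h z).inv ≫ (O.iso k (O.push h z)).inv) ≫
      ((O.iso k (O.push h z)).hom ≫ (P.map₂ η).toNatTrans.app _ ≫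
        (O.iso l (O.push h z)).inv) ≫
      (((O.iso l (O.push h z)).hom ≫ (P.map l).toFunctor.map (O.iso h z).hom) ≫
        (P.mapComp h l).inv.toNatTrans.app _) ≫ (O.iso (h ≫ l) z).inv
    simp)
  map₂_whisker_right {c d e h k} η l := cat_ext₂ fun (z : O.Full _) =>
      InducedCategory.hom_ext (by
    change (O.iso (h ≫ l) z).hom ≫ (P.map₂ (η ▷ l)).toNatTrans.app _ ≫ (O.iso (k ≫ l) z).inv =
      ((O.iso (h ≫ l) z).hom ≫ (P.mapComp h l).hom.toNatTrans.app _ ≫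
        (P.map l).toFunctor.map (O.iso h z).inv ≫ (O.iso l (O.push h z)).inv) ≫
      ((O.iso l (O.push h z)).hom ≫ (P.map l).toFunctor.map ((O.iso h z).hom ≫
        (P.map₂ η).toNatTrans.app _ ≫ (O.iso k z).inv) ≫ (O.iso l (O.push k z)).inv) ≫
      (((O.iso l (O.push k z)).hom ≫ (P.map l).toFunctor.map (O.iso k z).hom) ≫
        (P.mapComp k l).inv.toNatTrans.app _) ≫ (O.iso (k ≫ l) z).inv
    simp)
  map₂_associator h k l := cat_ext₂ fun (z : O.Full _) => InducedCategory.hom_ext (by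
    change (O.iso ((h ≫ k) ≫ l) z).hom ≫ (P.map₂ (α_ h k l).hom).toNatTrans.app _ ≫
        (O.iso (h ≫ k ≫ l) z).inv =
      ((O.iso ((h ≫ k) ≫ l) z).hom ≫ (P.mapComp (h ≫ k) l).hom.toNatTrans.app _ ≫
        (P.map l).toFunctor.map (O.iso (h ≫ k) z).inv ≫ (O.iso l (O.push (h ≫ k) z)).inv) ≫
      ((O.iso l (O.push (h ≫ k) z)).hom ≫ (P.map l).toFunctor.map ((O.iso (h ≫ k) z).hom ≫
        (P.mapComp h k).hom.toNatTrans.app _ ≫ (P.map k).toFunctor.map (O.iso h z).inv ≫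
          (O.iso k (O.push h z)).inv) ≫ (O.iso l (O.push k (O.push h z))).inv) ≫ 𝟙 _ ≫
      ((((O.iso l (O.push k (O.push h z))).hom ≫
        (P.map l).toFunctor.map (O.iso k (O.push h z)).hom) ≫
        (P.mapComp k l).inv.toNatTrans.app _) ≫ (O.iso (k ≫ l) (O.push h z)).inv) ≫
      (((O.iso (k ≫ l) (O.push h z)).hom ≫ (P.map (k ≫ l)).toFunctor.map (O.iso h z).hom) ≫
        (P.mapComp h (k ≫ l)).inv.toNatTrans.app _) ≫ (O.iso (h ≫ k ≫ l) z).inv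
    have h₁ : (P.map l).toFunctor.map ((P.map k).toFunctor.map (O.iso h z).inv) ≫
        (P.mapComp k l).inv.toNatTrans.app _ =
      (P.mapComp k l).inv.toNatTrans.app _ ≫ (P.map (k ≫ l)).toFunctor.map (O.iso h z).inv :=
      (P.mapComp k l).inv.toNatTrans.naturality (O.iso h z).inv
    simp [reassoc_of% h₁])
  map₂_left_unitor {c d} h := cat_ext₂ fun (z : O.Full _) => InducedCategory.hom_ext (by
    change (O.iso (𝟙 c ≫ h) z).hom ≫ (P.map₂ (λ_ h).hom).toNatTrans.app _ ≫ (O.iso h z).inv =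
      ((O.iso (𝟙 c ≫ h) z).hom ≫ (P.mapComp (𝟙 c) h).hom.toNatTrans.app _ ≫
        (P.map h).toFunctor.map (O.iso (𝟙 c) z).inv ≫ (O.iso h (O.push (𝟙 c) z)).inv) ≫
      ((O.iso h (O.push (𝟙 c) z)).hom ≫ (P.map h).toFunctor.map ((O.iso (𝟙 c) z).hom ≫
        (P.mapId c).hom.toNatTrans.app _) ≫ (O.iso h z).inv) ≫ 𝟙 _
    simp)
  map₂_right_unitor {c d} h := cat_ext₂ fun (z : O.Full _) => InducedCategory.hom_ext (by
    change (O.iso (h ≫ 𝟙 d) z).hom ≫ (P.map₂ (ρ_ h).hom).toNatTrans.app _ ≫ (O.iso h z).inv =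
      ((O.iso (h ≫ 𝟙 d) z).hom ≫ (P.mapComp h (𝟙 d)).hom.toNatTrans.app _ ≫
        (P.map (𝟙 d)).toFunctor.map (O.iso h z).inv ≫ (O.iso (𝟙 d) (O.push h z)).inv) ≫
      ((O.iso (𝟙 d) (O.push h z)).hom ≫ (P.mapId d).hom.toNatTrans.app _) ≫ 𝟙 _
    simp)

/-- The inclusion of the full subcategories. -/
def incl : O.psd ⟶ P :=
  mkTrans (P := O.psd) (fun c (z : O.Full c) => O.pt c z)
    (fun c (z z' : O.Full c) (f : z ⟶ z') => f.hom)
    (fun h z => O.iso h z)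
    (fun _ _ => rfl) (fun _ _ _ _ _ _ => rfl)
    (fun h (z z' : O.Full _) (f : z ⟶ z') => by
      change ((O.iso h z).hom ≫ (P.map h).toFunctor.map f.hom ≫ (O.iso h z').inv) ≫
        (O.iso h z').hom = (O.iso h z).hom ≫ (P.map h).toFunctor.map f.hom
      simp)
    (fun {c d h k} η (z : O.Full c) => by
      change ((O.iso h z).hom ≫ (P.map₂ η).toNatTrans.app _ ≫ (O.iso k z).inv) ≫
        (O.iso k z).hom = (O.iso h z).hom ≫ (P.map₂ η).toNatTrans.app _
      simp)
    (fun c (z : O.Full c) => rfl)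
    (fun {c d e} h k (z : O.Full c) => by
      change (O.iso (h ≫ k) z).hom ≫ (P.mapComp h k).hom.toNatTrans.app _ =
        ((O.iso (h ≫ k) z).hom ≫ (P.mapComp h k).hom.toNatTrans.app _ ≫
          (P.map k).toFunctor.map (O.iso h z).inv ≫ (O.iso k (O.push h z)).inv) ≫
        (O.iso k (O.push h z)).hom ≫ (P.map k).toFunctor.map (O.iso h z).hom
      simp)

section Section

variable (o : ∀ c, P.obj c → O.idx c) (e : ∀ c (y : P.obj c), O.pt c (o c y) ≅ y)

/-- A choice of indices for all the objects gives a pseudonatural transformation in the other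
direction. -/
def sec : P ⟶ O.psd :=
  mkTrans (Q := O.psd) (fun c y => (o c y : O.Full c))
    (fun c {x y} u => InducedCategory.homMk ((e c x).hom ≫ u ≫ (e c y).inv))
    (fun {c d} h y => InducedCategory.isoMk (e d _ ≪≫ (P.map h).toFunctor.mapIso (e c y).symm ≪≫
      (O.iso h (o c y)).symm))
    (fun c x => InducedCategory.hom_ext (by
      change (e c x).hom ≫ 𝟙 _ ≫ (e c x).inv = 𝟙 _
      simp))
    (fun c x y z u v => InducedCategory.hom_ext (by
      change (e c x).hom ≫ (u ≫ v) ≫ (e c z).inv =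
        ((e c x).hom ≫ u ≫ (e c y).inv) ≫ (e c y).hom ≫ v ≫ (e c z).inv
      simp))
    (fun {c d} h x y u => InducedCategory.hom_ext (by
      change ((e d _).hom ≫ (P.map h).toFunctor.map u ≫ (e d _).inv) ≫
          ((e d _).hom ≫ (P.map h).toFunctor.map (e c y).inv ≫ (O.iso h (o c y)).inv) =
        ((e d _).hom ≫ (P.map h).toFunctor.map (e c x).inv ≫ (O.iso h (o c x)).inv) ≫
          (O.iso h (o c x)).hom ≫ (P.map h).toFunctor.map ((e c x).hom ≫ u ≫ (e c y).inv) ≫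
            (O.iso h (o c y)).inv
      simp))
    (fun {c d h k} η x => InducedCategory.hom_ext (by
      change ((e d _).hom ≫ (P.map₂ η).toNatTrans.app x ≫ (e d _).inv) ≫
          ((e d _).hom ≫ (P.map k).toFunctor.map (e c x).inv ≫ (O.iso k (o c x)).inv) =
        ((e d _).hom ≫ (P.map h).toFunctor.map (e c x).inv ≫ (O.iso h (o c x)).inv) ≫
          (O.iso h (o c x)).hom ≫ (P.map₂ η).toNatTrans.app _ ≫ (O.iso k (o c x)).inv
      simp))
    (fun c x => InducedCategory.hom_ext (by
      change ((e c _).hom ≫ (P.map (𝟙 c)).toFunctor.map (e c x).inv ≫ (O.iso (𝟙 c) (o c x)).inv) ≫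
          (O.iso (𝟙 c) (o c x)).hom ≫ (P.mapId c).hom.toNatTrans.app _ =
        (e c _).hom ≫ (P.mapId c).hom.toNatTrans.app x ≫ (e c x).inv
      have := mapId_natural (P := P) (e c x).inv
      simp [this]))
    (fun {c d f} h k x => InducedCategory.hom_ext (by
      change ((e f _).hom ≫ (P.map (h ≫ k)).toFunctor.map (e c x).inv ≫
          (O.iso (h ≫ k) (o c x)).inv) ≫
          ((O.iso (h ≫ k) (o c x)).hom ≫ (P.mapComp h k).hom.toNatTrans.app _ ≫
          (P.map k).toFunctor.map (O.iso h (o c x)).inv ≫ (O.iso k (O.push h (o c x))).inv) =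
        ((e f _).hom ≫ (P.mapComp h k).hom.toNatTrans.app x ≫ (e f _).inv) ≫
        ((e f _).hom ≫ (P.map k).toFunctor.map (e d _).inv ≫ (O.iso k (o d _)).inv) ≫
        (O.iso k (o d _)).hom ≫ (P.map k).toFunctor.map ((e d _).hom ≫
          (P.map h).toFunctor.map (e c x).inv ≫ (O.iso h (o c x)).inv) ≫
          (O.iso k (O.push h (o c x))).inv
      have := mapComp_natural (P := P) h k (e c x).inv
      simp [reassoc_of% this]))

/-- The section followed by the inclusion. -/
def secInclIso : O.sec o e ≫ O.incl ≅ 𝟙 P :=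
  mkModifIso (s := O.sec o e ≫ O.incl) (t := 𝟙 P) (fun c y => e c y)
    (fun c {x y} u => by
      change ((e c x).hom ≫ u ≫ (e c y).inv) ≫ (e c y).hom = (e c x).hom ≫ u
      simp)
    (fun {c d} h x => by
      refine Eq.trans ?_ (congrArg (· ≫ (P.map h).toFunctor.map (e c x).hom)
        (natIso_comp_hom (O.sec o e) O.incl h x).symm)
      change (e d _).hom ≫ 𝟙 _ ≫ 𝟙 _ = (((e d _).hom ≫ (P.map h).toFunctor.map (e c x).inv ≫
        (O.iso h (o c x)).inv) ≫ (O.iso h (o c x)).hom) ≫ (P.map h).toFunctor.map (e c x).hom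
      simp)

/-- The inclusion followed by the section. -/
def inclSecIso : O.incl ≫ O.sec o e ≅ 𝟙 O.psd :=
  mkModifIso (s := O.incl ≫ O.sec o e) (t := 𝟙 O.psd)
    (fun c (z : O.Full c) => InducedCategory.isoMk (e c (O.pt c z)))
    (fun c (z z' : O.Full c) (u : z ⟶ z') => InducedCategory.hom_ext (by
      change ((e c _).hom ≫ u.hom ≫ (e c _).inv) ≫ (e c _).hom = (e c _).hom ≫ u.hom
      simp))
    (fun {c d} h (z : O.Full c) => InducedCategory.hom_ext (by
      refine Eq.trans ?_ (congrArg (fun t => InducedCategory.Hom.hom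
        (t ≫ (O.map h).map (InducedCategory.homMk (e c (O.pt c z)).hom)))
        (natIso_comp_hom O.incl (O.sec o e) h z).symm)
      change (e d _).hom ≫ 𝟙 _ ≫ 𝟙 _ = (((e d _).hom ≫ (O.iso h z).hom ≫ (e d _).inv) ≫
        (e d _).hom ≫ (P.map h).toFunctor.map (e c _).inv ≫ (O.iso h (o c _)).inv) ≫
        (O.iso h (o c _)).hom ≫ (P.map h).toFunctor.map (e c _).hom ≫ (O.iso h z).inv
      simp [← CategoryTheory.Functor.map_comp_assoc]))

end Section

end ObjFamily

end Induced

/-! ### Strict functoriality of the replacement -/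

section StrictFamilies

theorem inducedCategory_eqToHom_hom {C : Type u₁} {D : Type u₂} [Category.{v₂} D] {F : C → D}
    {x y : InducedCategory D F} (h : x = y) :
    (eqToHom h).hom = eqToHom (congrArg F h) := by
  subst h; rfl

variable {A : Type u} [Bicategory.{w, v} A]

theorem mapId_app_eq (P : StrictPseudofunctor A Cat.{w₁, v₁}) (c : A) (x : P.obj c)
    (h : (P.map (𝟙 c)).toFunctor.obj x = x) :
    (P.mapId c).hom.toNatTrans.app x = eqToHom h := by
  rw [P.mapId_eq_eqToIso, eqToIso.hom, Cat.eqToHom_app]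

theorem mapComp_app_eq (P : StrictPseudofunctor A Cat.{w₁, v₁}) {c d e : A} (h : c ⟶ d)
    (k : d ⟶ e) (x : P.obj c)
    (hx : (P.map (h ≫ k)).toFunctor.obj x =
      (P.map k).toFunctor.obj ((P.map h).toFunctor.obj x)) :
    (P.mapComp h k).hom.toNatTrans.app x = eqToHom hx := by
  rw [P.mapComp_eq_eqToIso, eqToIso.hom, Cat.eqToHom_app]

theorem map_id_obj (P : StrictPseudofunctor A Cat.{w₁, v₁}) (c : A) (x : P.obj c) :
    (P.map (𝟙 c)).toFunctor.obj x = x := by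
  rw [P.map_id]; rfl

theorem map_comp_obj (P : StrictPseudofunctor A Cat.{w₁, v₁}) {c d e : A} (h : c ⟶ d)
    (k : d ⟶ e) (x : P.obj c) : (P.map (h ≫ k)).toFunctor.obj x =
      (P.map k).toFunctor.obj ((P.map h).toFunctor.obj x) := by
  rw [P.map_comp]; rfl

/-- The `2`-functor of full subcategories on a strictly functorial family of objects. -/
def ObjFamily.strict {P : StrictPseudofunctor A Cat.{w₁, v₁}} (O : ObjFamily P.toPseudofunctor)
    (hpt : ∀ {c d : A} (h : c ⟶ d) (z : O.idx c),
      O.pt d (O.push h z) = (P.map h).toFunctor.obj (O.pt c z))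
    (hiso : ∀ {c d : A} (h : c ⟶ d) (z : O.idx c), O.iso h z = eqToIso (hpt h z))
    (push_id : ∀ (c : A) (z : O.idx c), O.push (𝟙 c) z = z)
    (push_comp : ∀ {c d e : A} (h : c ⟶ d) (k : d ⟶ e) (z : O.idx c),
      O.push (h ≫ k) z = O.push k (O.push h z)) : StrictPseudofunctor A Cat.{w₁, v₁} :=
  -- The structural isomorphisms are composites of equality morphisms in `P`. Distinct indices may
  -- name the same object, so strictness also needs the equalities of indices `push_id` and
  -- `push_comp`.
  have hi (c : A) (z : O.Full c) : ((O.psd.mapId c).hom.toNatTrans.app z) =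
      @eqToHom (O.Full c) _ (O.push (𝟙 c) z) z (push_id c z) := InducedCategory.hom_ext (by
    rw [inducedCategory_eqToHom_hom]
    change (O.iso (𝟙 c) z).hom ≫ (P.mapId c).hom.toNatTrans.app (O.pt c z) = _
    rw [hiso, mapId_app_eq P c _ (map_id_obj P c _), eqToIso.hom]
    exact eqToHom_trans _ _)
  have hc {c d e : A} (h : c ⟶ d) (k : d ⟶ e) (z : O.Full c) :
      ((O.psd.mapComp h k).hom.toNatTrans.app z) =
        @eqToHom (O.Full e) _ (O.push (h ≫ k) z) (O.push k (O.push h z)) (push_comp h k z) :=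
      InducedCategory.hom_ext (by
    rw [inducedCategory_eqToHom_hom]
    change (O.iso (h ≫ k) z).hom ≫ (P.mapComp h k).hom.toNatTrans.app (O.pt c z) ≫
      (P.map k).toFunctor.map (O.iso h z).inv ≫ (O.iso k (O.push h z)).inv = _
    rw [hiso, hiso, hiso, mapComp_app_eq P h k _ (map_comp_obj P h k _)]
    simp [eqToHom_map])
  { O.psd with
    map_id := fun c => cat_eq (O.psd.mapId c) (push_id c) (hi c)
    map_comp := fun h k => cat_eq (O.psd.mapComp h k) (push_comp h k) (hc h k)
    mapId_eq_eqToIso := fun c => cat_eqToIso (O.psd.mapId c) (push_id c) (hi c) _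
    mapComp_eq_eqToIso := fun h k => cat_eqToIso (O.psd.mapComp h k) (push_comp h k) (hc h k) _ }

end StrictFamilies

/-! ### Equality of transformations and cones from identity isomorphisms -/

section Extensionality

namespace SigmaCone

variable {I : Type u₁} [Bicategory.{w₁, v₁} I] {B : Type u₂} [Bicategory.{w₂, v₂} B]
  {S : WideSub I} {F : StrictPseudofunctor I B} {E : B}

/-- When the components of an isomorphism are identities, its compatibility with the structural
cells says that these cells are equal. -/
theorem eq_of_iso {θ θ' : SigmaCone S F E} (e : θ ≅ θ') (h : ∀ i, θ.app i = θ'.app i)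
    (he : ∀ i, e.hom.app i = eqToHom (h i)) : θ = θ' := by
  obtain ⟨t, κ, _, _, _, _⟩ := θ
  obtain ⟨t', κ', _, _, _, _⟩ := θ'
  obtain rfl : t = t' := funext h
  have : @κ = @κ' := by
    funext i j f
    have := e.hom.w f
    rw [he, he] at this
    simpa using this.symm
  subst this
  rfl

theorem eqToHom_app {θ θ' : SigmaCone S F E} (h : θ = θ') (i : I) :
    (eqToHom h).app i = eqToHom (congrArg (fun θ => θ.app i) h) := by
  subst h; rfl

end SigmaCone

variable {A : Type u} [Bicategory.{w, v} A]

theorem homP_eqToHom_app {F G : HomP A Cat.{w₁, v₁}} {s t : F ⟶ G} (h : s = t) (c : A)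
    (x : F.psd.obj c) : ((eqToHom h).hom.as.app c).toNatTrans.app x =
      eqToHom (congrArg (fun r : F ⟶ G => (r.hom.app c).toFunctor.obj x) h) := by
  subst h; rfl

/-- Isomorphic arrows of `HomP` are equal if the components of the isomorphism are identities. -/
theorem homP_eq_of_components {F G : HomP A Cat.{w₁, v₁}} {s t : F ⟶ G} (e : s ≅ t)
    (h : ∀ c (x : F.psd.obj c), (s.hom.app c).toFunctor.obj x = (t.hom.app c).toFunctor.obj x)
    (he : ∀ c (x : F.psd.obj c), (e.hom.hom.as.app c).toNatTrans.app x = eqToHom (h c x)) :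
    s = t := by
  let e' (c : A) : s.hom.app c ≅ t.hom.app c :=
    ⟨e.hom.hom.as.app c, e.inv.hom.as.app c,
      congrArg (fun r : s ⟶ s => r.hom.as.app c) e.hom_inv_id,
      congrArg (fun r : t ⟶ t => r.hom.as.app c) e.inv_hom_id⟩
  have hF (c : A) : s.hom.app c = t.hom.app c := cat_eq (e' c) (h c) (he c)
  exact homP_eq e hF (fun c => congrArg Iso.hom (cat_eqToIso (e' c) (h c) (he c) (hF c)))

/-- Isomorphic `σ`-cones in `HomP` are equal if the components of the isomorphism are
identities. -/
theorem SigmaCone.eq_of_components {I : Type u₂} [Bicategory.{w₂, v₂} I] {S : WideSub I}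
    {F : StrictPseudofunctor I (HomP A Cat.{w₁, v₁})} {E : HomP A Cat.{w₁, v₁}}
    {θ θ' : SigmaCone S F E} (e : θ ≅ θ')
    (h : ∀ i c (x : (F.obj i).psd.obj c), ((θ.app i).hom.app c).toFunctor.obj x =
      ((θ'.app i).hom.app c).toFunctor.obj x)
    (he : ∀ i c (x : (F.obj i).psd.obj c), ((e.hom.app i).hom.as.app c).toNatTrans.app x =
      eqToHom (h i c x)) : θ = θ' := by
  have happ (i : I) : θ.app i = θ'.app i :=
    homP_eq_of_components (SigmaCone.appIso e i) (h i) (he i)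
  exact SigmaCone.eq_of_iso e happ fun i => homP_ext₂ fun c x =>
    (he i c x).trans (homP_eqToHom_app (happ i) c x).symm

end Extensionality


/-! ### The strict σ-colimit over a small set of objects -/

section Small

variable {A : Type u} [Bicategory.{w, v} A] (P : StrictPseudofunctor A Cat.{w, v})

/-- Objects of the colimit at `c`: a point of `P` together with an arrow from its base to `c`. -/
abbrev Pointed (c : A) := Σ X : El P, (X.base ⟶ c)

variable [Small.{v} A]

instance : Small.{v} (El P) :=
  small_of_injective (β := Σ a : A, P.obj a) (f := fun X => ⟨X.base, X.pt⟩)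
    (by rintro ⟨a, x⟩ ⟨b, y⟩ h; cases h; rfl)

/-- The indices of the pointed arrows. -/
noncomputable abbrev shr (c : A) : Pointed P c ≃ Shrink.{v} (Pointed P c) := equivShrink _

/-- The object of `P c` determined by a pointed arrow. -/
def Pointed.obj {P : StrictPseudofunctor A Cat.{w, v}} {c : A} (t : Pointed P c) : P.obj c :=
  (P.map t.2).toFunctor.obj t.1.pt

theorem pointedFamily_pt {c d : A} (h : c ⟶ d) (z : Shrink.{v} (Pointed P c)) :
    ((shr P d).symm (shr P d ⟨((shr P c).symm z).1, ((shr P c).symm z).2 ≫ h⟩)).obj =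
      (P.map h).toFunctor.obj ((shr P c).symm z).obj := by
  rw [Equiv.symm_apply_apply]
  exact map_comp_obj P _ _ _

/-- The objects `P g x` of `P c`, indexed by the pointed arrows. -/
noncomputable def pointedFamily : ObjFamily P.toPseudofunctor where
  idx c := Shrink.{v} (Pointed P c)
  pt c z := ((shr P c).symm z).obj
  push {c d} h z := shr P d ⟨((shr P c).symm z).1, ((shr P c).symm z).2 ≫ h⟩
  iso h z := eqToIso (pointedFamily_pt P h z)

theorem pointedFamily_sec (c : A) (y : P.obj c) :
    ((shr P c).symm (shr P c ⟨El.mk c y, 𝟙 c⟩)).obj = y := by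
  rw [Equiv.symm_apply_apply]
  exact map_id_obj P c y

/-- The inverse of the inclusion of the full subcategories. -/
noncomputable def pointedSec : P.toPseudofunctor ⟶ (pointedFamily P).psd :=
  (pointedFamily P).sec (fun c y => shr P c ⟨El.mk c y, 𝟙 c⟩)
    (fun c y => eqToIso (pointedFamily_sec P c y))

variable [Strict A]

/-- The vertex of the `σ`-colimit. -/
noncomputable def colimVertex : HomP A Cat.{w, v} :=
  HomP.of ((pointedFamily P).strict (fun h z => pointedFamily_pt P h z) (fun _ _ => rfl)
    (fun c z => by
      -- Indices are pushed forward by postcomposition, which is strictly unital and associative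
      -- because `A` is strict.
      refine Eq.trans ?_ ((shr P c).apply_symm_apply z)
      exact congrArg (shr P c) (Sigma.ext rfl (heq_of_eq (Strict.comp_id _))))
    (fun {c d e} h k z => by
      change shr P e _ = shr P e ⟨((shr P d).symm (shr P d ⟨_, _⟩)).1,
        ((shr P d).symm (shr P d ⟨_, _⟩)).2 ≫ k⟩
      rw [Equiv.symm_apply_apply]
      exact congrArg (shr P e) (Sigma.ext rfl (heq_of_eq (Strict.assoc _ _ _).symm))))

/-- The comparison from `P` to the vertex of the `σ`-colimit. -/
noncomputable def toColim : HomP.of P ⟶ colimVertex P :=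
  InducedBicategory.mkHom (X := HomP.of P) (Y := colimVertex P) (pointedSec P)

/-- The comparison from the vertex of the `σ`-colimit to `P`. -/
noncomputable def fromColim : colimVertex P ⟶ HomP.of P :=
  InducedBicategory.mkHom (X := colimVertex P) (Y := HomP.of P) (pointedFamily P).incl

noncomputable def toFromColim : toColim P ≫ fromColim P ≅ 𝟙 (HomP.of P) :=
  InducedBicategory.isoMk ((pointedFamily P).secInclIso _ _)

noncomputable def fromToColim : fromColim P ≫ toColim P ≅ 𝟙 (colimVertex P) :=
  InducedBicategory.isoMk ((pointedFamily P).inclSecIso _ _)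

/-- The indices (X, g) and ((P g x, c), 1) are in general different but name the same object of `P
c`; they become isomorphic, not equal, in the vertex. -/
theorem shr_obj_eq {X : El P} {c : A} (g : X.base ⟶ c) :
    ((shr P c).symm (shr P c ⟨X, g⟩)).obj =
      ((shr P c).symm (shr P c ⟨El.mk c ((P.map g).toFunctor.obj X.pt), 𝟙 c⟩)).obj := by
  rw [pointedFamily_sec, Equiv.symm_apply_apply]
  rfl

/-- The index of a pointed arrow, as an object of the vertex of the `σ`-colimit. -/
noncomputable def Pointed.ix {P : StrictPseudofunctor A Cat.{w, v}} {c : A} (t : Pointed P c) :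
    (pointedFamily P).Full c := shr P c t

/-- The isomorphism of the value of the colimit cone with the image of a point. -/
noncomputable def colimLegObjIso (X : El P) (c : A) (g : X.base ⟶ c) :
    Pointed.ix ⟨X, g⟩ ≅
      (Pointed.ix ⟨El.mk c ((P.map g).toFunctor.obj X.pt), 𝟙 c⟩ : (pointedFamily P).Full c) :=
  InducedCategory.isoMk (eqToIso (shr_obj_eq P g))

/-- The legs of the colimit cone. -/
noncomputable def colimLeg (X : El P) :
    (rep X.base).toPseudofunctor ⟶ (colimVertex P).psd :=
  -- The composite alone would send `g` to the index ((P g x, c), 1) and forget X and g; the copy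
  -- keeps the pair itself.
  copyObj (pointLeg X ≫ pointedSec P)
    (fun c (g : X.base ⟶ c) => (Pointed.ix ⟨X, g⟩ : (pointedFamily P).Full c))
    (colimLegObjIso P X)

/-- The colimit cone. -/
noncomputable def colimCone : SigmaCone (El.cart P).op (repDiagram P) (colimVertex P) :=
  (((pointCone P).precomp _).obj (toColim P)).copy
    (fun i => InducedBicategory.mkHom (colimLeg P i.unop))
    (fun i => InducedBicategory.isoMk (copyObjIso (pointLeg i.unop ≫ pointedSec P)
      (fun c (g : i.unop.base ⟶ c) => (Pointed.ix ⟨i.unop, g⟩ : (pointedFamily P).Full c))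
      (colimLegObjIso P i.unop)))

/-- Up to isomorphism this cone is the Yoneda cone composed with the equivalence `toColim P`. -/
theorem isSigmaBicolimit_colimCone : IsSigmaBicolimit (colimCone P) :=
  (isSigmaBicolimit_pointCone P).of_equivalence (toFromColim P) (fromToColim P)
    (SigmaCone.copyIso _ _ _).symm

variable {P} {Q : HomP A Cat.{w, v}}

/-- Equality of the composite cones is an isomorphism with identity components, and full
faithfulness lifts it to `s ≅ t`. Every object of the vertex is a value of a leg, so the lift has
identity components too, and `s = t`. -/
theorem precomp_colimCone_injective :
    Function.Injective ((colimCone P).precomp Q).obj := fun s t h => by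
  have := isSigmaBicolimit_colimCone P Q
  let e : s ≅ t := ((colimCone P).precomp Q).preimageIso (eqToIso h)
  have he : ((colimCone P).precomp Q).map e.hom = eqToHom h := by simp [e]
  refine homP_eq_of_components e (fun c z => ?_) (fun c z => ?_)
  · obtain ⟨⟨X, g⟩, rfl⟩ := (shr P c).surjective z
    exact congrArg (fun θ : SigmaCone (El.cart P).op (repDiagram P) Q => legObj θ X g) h
  · obtain ⟨⟨X, g⟩, rfl⟩ := (shr P c).surjective z
    have := congrArg (fun r => ((r.app (op X)).hom.as.app c).toNatTrans.app g) he
    refine Eq.trans this ?_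
    rw [SigmaCone.eqToHom_app]
    exact homP_eqToHom_app _ _ _

/-- Transport along `sh.symm (sh t) = t` is absorbed by the family `a`; replacing `sh.symm (sh t)`
by a variable equal to `t` allows that equality to be eliminated. -/
theorem hom_eqToHom_inv_family {T Z C : Type*} [Category* C] (sh : T ≃ Z) {F : T → C} {G : Z → C}
    (a : ∀ t, F t ≅ G (sh t)) (t : T) :
    ((a (sh.symm (sh t))).hom ≫ eqToHom (by simp)) ≫ (a t).inv = eqToHom (by simp) := by
  have : ∀ (t' : T) (h : t' = t), ((a t').hom ≫ eqToHom (by rw [h])) ≫ (a t).inv =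
      eqToHom (by rw [h]) := by
    rintro _ rfl; simp
  exact this _ (sh.symm_apply_apply t)

/-- Essential surjectivity gives `s` whose composite cone is isomorphic to `θ`. Each object of the
vertex comes from exactly one pair (X, g), so `s` can be replaced by an isomorphic copy taking there
exactly the value of `θ`; the isomorphism of cones then has identity components. -/
theorem precomp_colimCone_surjective :
    Function.Surjective ((colimCone P).precomp Q).obj := fun θ => by
  have := isSigmaBicolimit_colimCone P Q
  let s := ((colimCone P).precomp Q).objPreimage θ
  let i : ((colimCone P).precomp Q).obj s ≅ θ := ((colimCone P).precomp Q).objObjPreimageIso θ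
  let a (c : A) (t : Pointed P c) : legObj θ t.1 t.2 ≅
      (s.hom.app c).toFunctor.obj t.ix :=
    ⟨((i.inv.app (op t.1)).hom.as.app c).toNatTrans.app t.2,
      ((i.hom.app (op t.1)).hom.as.app c).toNatTrans.app t.2,
      congrArg (fun r : θ ⟶ θ => ((r.app (op t.1)).hom.as.app c).toNatTrans.app t.2)
        i.inv_hom_id,
      congrArg (fun r : ((colimCone P).precomp Q).obj s ⟶ ((colimCone P).precomp Q).obj s =>
        ((r.app (op t.1)).hom.as.app c).toNatTrans.app t.2) i.hom_inv_id⟩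
  -- The prescribed value at an index is that of `θ` at the pair it encodes; the equality morphism
  -- accounts for decoding and encoding again.
  let b (c : A) (z : (pointedFamily P).Full c) :
      legObj θ ((shr P c).symm z).1 ((shr P c).symm z).2 ≅ (s.hom.app c).toFunctor.obj z :=
    a c _ ≪≫ eqToIso (congrArg (s.hom.app c).toFunctor.obj ((shr P c).apply_symm_apply z))
  let j := copyObjIso s.hom (fun c (z : (pointedFamily P).Full c) =>
    legObj θ ((shr P c).symm z).1 ((shr P c).symm z).2) b
  let t : colimVertex P ⟶ Q := InducedBicategory.mkHom (copyObj s.hom _ b)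
  let j' : t ≅ s := InducedBicategory.isoMk j
  refine ⟨t, SigmaCone.eq_of_components (((colimCone P).precomp Q).mapIso j' ≪≫ i) ?_ ?_⟩
  · intro X c g
    exact congrArg (fun t : Pointed P c => legObj θ t.1 t.2)
      ((shr P c).symm_apply_apply ⟨X.unop, g⟩)
  · intro X c g
    exact hom_eqToHom_inv_family (shr P c) (F := fun t => legObj θ t.1 t.2)
      (G := (s.hom.app c).toFunctor.obj) (a c) ⟨X.unop, g⟩

theorem isSigmaColimit_colimCone : IsSigmaColimit (colimCone P) :=
  (isSigmaBicolimit_colimCone P).isSigmaColimit fun _ =>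
    ⟨precomp_colimCone_injective, precomp_colimCone_surjective⟩

end Small

end TwoCat

theorem mainTheorem4 {A : Type u} [Bicategory.{w, v} A] [Strict A]
    (P : StrictPseudofunctor A Cat.{w, v}) :
    (∀ (L : TwoCat.HomP A Cat.{w, v})
      (lam : TwoCat.SigmaCone (TwoCat.El.cart P).op (TwoCat.repDiagram P) L),
      TwoCat.IsSigmaColimit lam →
        Nonempty (Bicategory.Equivalence (TwoCat.HomP.of P) L)) ∧
    (Small.{v} A →
      ∃ (L : TwoCat.HomP A Cat.{w, v})
        (lam : TwoCat.SigmaCone (TwoCat.El.cart P).op (TwoCat.repDiagram P) L),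
        TwoCat.IsSigmaColimit lam) ∧
    (∃ nu : TwoCat.SigmaCone (TwoCat.El.cart P).op (TwoCat.repDiagram P) (TwoCat.HomP.of P),
      TwoCat.IsSigmaBicolimit nu) :=
  ⟨fun _ _ h => (TwoCat.isSigmaBicolimit_pointCone P).nonempty_equivalence h.isSigmaBicolimit,
    fun _ => ⟨TwoCat.colimVertex P, TwoCat.colimCone P, TwoCat.isSigmaColimit_colimCone⟩,
    ⟨TwoCat.pointCone P, TwoCat.isSigmaBicolimit_pointCone P⟩⟩
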